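/- Let $\Omega$ be a measurable space, $G_0$ a finite non-zero measure on $\Omega$ with total mass $\gamma_0=G_0(\Omega)$ and $g_0=G_0/\gamma_0$, and let $\rho$ be a measure on $\mathbb R_+=[0,\infty)$ with $\rho((0,\infty))>0$ such that $\nu(dr\,d\omega)=\rho(dr)G_0(d\omega)$ satisfies $\iint_{\mathbb R_+\times A}\min\{1,r\}\,\nu(dr\,d\omega)<\infty$ for every measurable $A\subset\Omega$. Let $G=\sum_{k=1}^K r_k\delta_{\omega_k}$ ($K\le\infty$) be a completely random measure with Lévy measure $\nu$: a random measure such that each $G(A)$ is almost surely finite, $G(A_1),G(A_2),\dots$ are independent for pairwise disjoint measurable $A_i$, and $$\mathbb E\big[e^{iuG(A)}\big]=\exp\Big\{\iint_{\mathbb R_+\times A}(e^{iur}-1)\,\nu(dr\,d\omega)\Big\}\qquad(u\in\mathbb R).$$ Given the weights $(r_k)$ and the atoms $(\omega_k)$, let the counts $n_k\sim\mathrm{Pois}(r_k)$ be independent, and put $X=\sum_{k=1}^K n_k\delta_{\omega_k}$. Then $0<\int_0^\infty(1-e^{-r})\rho(dr)<\infty$, $\int_0^\infty r^je^{-r}\rho(dr)<\infty$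 for all $j\ge1$, and $X$ is a compound Poisson process: as a random measure it has the same law as $$\sum_{k=1}^{l} n'_k\,\delta_{\omega'_k},\qquad l\sim\mathrm{Pois}\Big(\gamma_0\int_0^\infty(1-e^{-r})\rho(dr)\Big),\qquad \omega'_k\overset{iid}{\sim}g_0,\qquad n'_k\overset{iid}{\sim}\sum_{j=1}^\infty\frac{\int_0^\infty r^je^{-r}\rho(dr)}{j!\int_0^\infty(1-e^{-r})\rho(dr)}\,\delta_j,$$ where $l$, $(n'_k)_k$ and $(\omega'_k)_k$ are independent. If moreover $G_0$ has no atoms and the points of $\Omega$ are separated by countably many measurable sets (for instance, if $\Omega$ is a standard Borel space), then the number of clusters, that is, of points $\omega\in\Omega$ with $X(\{\omega\})>0$, is Poisson distributed with mean $\gamma_0\int_0^\infty(1-e^{-r})\rho(dr)$. -/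

import Mathlib

open MeasureTheory ProbabilityTheory
open scoped NNReal ENNReal

noncomputable section

namespace CountMixture

universe u v

/-- The purely atomic measure `∑ₖ wₖ δ_{xₖ}`. A sum with `K < ∞` terms is the case in which
`wₖ = 0` for all remaining indices. -/
def atomic {S : Type u} [MeasurableSpace S] (w : ℕ → ℝ≥0∞) (x : ℕ → S) : Measure S :=
  Measure.sum fun k => w k • Measure.dirac (x k)

/-- The condition `∫∫_{ℝ₊ × A} min(1, r) ν(dr dω) < ∞` for all measurable `A`. -/
def IsLevyMeasure {S : Type u} [MeasurableSpace S] (ν : Measure (ℝ≥0 × S)) : Prop :=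
  ∀ A : Set S, MeasurableSet A → ∫⁻ p in Set.univ ×ˢ A, min 1 (p.1 : ℝ≥0∞) ∂ν < ∞

/-- `G` is a completely random measure on `S` with Lévy measure `ν`: a random measure with finite
values, independent on disjoint sets, and with characteristic functions
`E[exp(iuG(A))] = exp(∫∫_{ℝ₊ × A} (exp(iur) - 1) ν(dr dω))`. -/
structure IsCompletelyRandomMeasure {S : Type u} [MeasurableSpace S] {Θ : Type v}
    [MeasurableSpace Θ] (P : Measure Θ) (G : Θ → Measure S) (ν : Measure (ℝ≥0 × S)) : Prop where
  measurable : Measurable G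
  finite : ∀ A : Set S, MeasurableSet A → ∀ᵐ θ ∂P, G θ A < ∞
  indep : ∀ A : ℕ → Set S, (∀ i, MeasurableSet (A i)) → Pairwise (Function.onFun Disjoint A) →
    iIndepFun (fun i θ => G θ (A i)) P
  charFun_eq : ∀ A : Set S, MeasurableSet A → ∀ t : ℝ,
    ∫ θ, Complex.exp (t * (G θ).real A * Complex.I) ∂P =
      Complex.exp (∫ p in Set.univ ×ˢ A, (Complex.exp (t * (p.1 : ℝ) * Complex.I) - 1) ∂ν)

/-- The count-mixture model with random weights `rₖ`, atoms `ωₖ` and counts `nₖ`: the random measure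
`G = ∑ₖ rₖ δ_{ωₖ}` is a completely random measure with Lévy measure `ν` and, given the weights and
atoms, the counts are independent with `nₖ ∼ Pois(rₖ)`. -/
structure IsCountMixtureModel {S : Type u} [MeasurableSpace S] {Θ : Type v}
    [MeasurableSpace Θ] (P : Measure Θ) (ν : Measure (ℝ≥0 × S))
    (r : ℕ → Θ → ℝ≥0) (ω : ℕ → Θ → S) (n : ℕ → Θ → ℕ) : Prop where
  measurable_weight : ∀ k, Measurable (r k)
  measurable_atom : ∀ k, Measurable (ω k)
  measurable_count : ∀ k, Measurable (n k)
  isCRM : IsCompletelyRandomMeasure P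
    (fun θ => atomic (fun k => (r k θ : ℝ≥0∞)) (fun k => ω k θ)) ν
  count_condLaw : ∀ (s : Finset ℕ) (j : ℕ → ℕ),
    P[{θ | ∀ k ∈ s, n k θ = j k}.indicator (fun _ => (1 : ℝ)) |
        MeasurableSpace.comap (fun θ k => (r k θ, ω k θ)) inferInstance]
      =ᵐ[P] fun θ => ∏ k ∈ s, (poissonMeasure (r k θ)).real {j k}

/-- The random measure `X = ∑ₖ nₖ δ_{ωₖ}`. -/
def countMeasure {S : Type u} [MeasurableSpace S] {Θ : Type v}
    (ω : ℕ → Θ → S) (n : ℕ → Θ → ℕ) (θ : Θ) : Measure S :=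
  atomic (fun k => (n k θ : ℝ≥0∞)) (fun k => ω k θ)

/-- `X` is a compound Poisson process with rate `lam`, size law `q` and location law `g`: it has
the law of `∑_{k < l} nₖ δ_{ωₖ}`, with `l ∼ Pois(lam)`, `nₖ` iid from `q`, `ωₖ` iid from `g`, all
independent. -/
def IsCompoundPoissonProcess {S : Type u} [MeasurableSpace S] {Θ : Type v}
    [MeasurableSpace Θ] (P : Measure Θ) (X : Θ → Measure S)
    (lam : ℝ≥0) (q : Measure ℕ) (g : Measure S) : Prop :=
  ∃ (Θ' : Type u) (_ : MeasurableSpace Θ') (Q : Measure Θ') (_ : IsProbabilityMeasure Q)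
    (l : Θ' → ℕ) (n : ℕ → Θ' → ℕ) (ω : ℕ → Θ' → S),
    HasLaw l (poissonMeasure lam) Q ∧ (∀ k, HasLaw (n k) q Q) ∧ (∀ k, HasLaw (ω k) g Q) ∧
    (∀ k, IndepFun (n k) (ω k) Q) ∧
    iIndepFun (fun k θ => (n k θ, ω k θ)) Q ∧
    IndepFun l (fun θ k => (n k θ, ω k θ)) Q ∧
    IdentDistrib X
      (fun θ => ∑ k ∈ Finset.range (l θ), (n k θ : ℝ≥0∞) • Measure.dirac (ω k θ)) P Q

/-- The probability of cluster size `j`: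
`∫ r^j e^{-r} ρ(dr) / (j! ∫ (1 - e^{-r}) ρ(dr))`. -/
def sizeProb (ρ : Measure ℝ≥0) (j : ℕ) : ℝ :=
  (∫ r : ℝ≥0, (r : ℝ) ^ j * Real.exp (-r) ∂ρ) /
    (j.factorial * ∫ r : ℝ≥0, (1 - Real.exp (-r)) ∂ρ)

/-- The cluster size law `∑_{j ≥ 1} sizeProb ρ j • δ_j`. -/
def sizeLaw (ρ : Measure ℝ≥0) : Measure ℕ :=
  Measure.sum fun i : ℕ => ENNReal.ofReal (sizeProb ρ (i + 1)) • Measure.dirac (i + 1)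

/-- The mean number of clusters `γ₀ ∫ (1 - e^{-r}) ρ(dr)`, where `γ₀` is the mass of `G₀`. -/
def clusterRate {S : Type u} [MeasurableSpace S] (ρ : Measure ℝ≥0) (G₀ : Measure S) : ℝ≥0 :=
  (G₀.real Set.univ * ∫ r : ℝ≥0, (1 - Real.exp (-r)) ∂ρ).toNNReal

/-- The base distribution `g₀ = G₀ / γ₀`. -/
def baseLaw {S : Type u} [MeasurableSpace S] (G₀ : Measure S) : Measure S :=
  (G₀ Set.univ)⁻¹ • G₀

end CountMixture

end

/-! The law of a random measure is determined by its Laplace functional `f ↦ E exp(-∫ f dX)`, and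
bounded integer-valued `f` suffice (`ext_of_laplaceFunctional`). Such an `f` has finitely many
nonempty level sets `B_j = f⁻¹{j}`, over which the functional of a completely random measure
factors. Write `Φ(c) = ∫ (1 - e^{-cr}) ρ(dr)` and `ψ = Φ(1)`.

For the model, integrating out the Poisson counts turns `exp(-n_k f(ω_k))` into `exp(-r_k (1 -
e^{-f(ω_k)}))`. Hence the functional of `X` at `f` is that of `G` at `1 - e^{-f}`, namely `exp(-∑_j
G₀(B_j) Φ(1 - e^{-j}))`. The hypothesis on `G(A)` concerns characteristic functions only. Both sides
of it extend to bounded holomorphic functions on the right half-plane, continuous up to the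
imaginary axis, so Phragmén–Lindelöf carries the identity to the positive reals
(`integral_exp_neg_mul_eq_of_charFun_eq`).

For the compound Poisson process the functional is `exp(-λ(1 - m))` with `m = E exp(-n' f(ω'))`. The
size law is the Poisson mixture `∫ Pois(r) ρ(dr)` restricted to `j ≥ 1` and divided by `ψ`, and its
generating function is `1 - Φ(1 - y)/ψ`. With `λ = γ₀ψ` the two exponents agree.

The number of clusters is determined by the law of `X`: on atomic measures, having exactly `j` atoms
is a measurable condition. In the compound Poisson representation the sizes are positive and, for
diffuse `G₀`, the locations are almost surely distinct, so the number of clusters is `l`. -/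

noncomputable section

namespace CountMixture

/-! ### From characteristic functions to Laplace transforms -/

open Complex in
/-- The Lévy exponent is bounded by a multiple of `min 1 r`. -/
lemma norm_cexp_neg_mul_sub_one_le {z : ℂ} (hz : 0 ≤ z.re) {r : ℝ} (hr : 0 ≤ r) :
    ‖cexp (-z * r) - 1‖ ≤ max 2 ‖z‖ * min 1 r := by
  have h2 : ‖cexp (-z * r) - 1‖ ≤ 2 := by
    have h1 : ‖cexp (-z * r)‖ ≤ 1 := by
      rw [Complex.norm_exp]
      simpa using mul_nonneg hz hr
    calc _ ≤ ‖cexp (-z * r)‖ + ‖(1 : ℂ)‖ := norm_sub_le _ _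
      _ ≤ 2 := by rw [norm_one]; linarith
  have h3 : ‖cexp (-z * r) - 1‖ ≤ ‖z‖ * r := by
    -- Mean value inequality for `t ↦ e^{-zt}` on `[0, r]`, whose derivative has norm at most `‖z‖`.
    have key := Convex.norm_image_sub_le_of_norm_hasDerivWithin_le (𝕜 := ℝ) (s := Set.Icc 0 r)
      (f := fun t : ℝ => cexp (-z * t)) (f' := fun t : ℝ => cexp (-z * t) * (-z)) (C := ‖z‖)
      (x := 0) (y := r) ?_ ?_ (convex_Icc _ _) ⟨le_rfl, hr⟩ ⟨hr, le_rfl⟩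
    · simpa [abs_of_nonneg hr] using key
    · intro t _
      apply HasDerivAt.hasDerivWithinAt
      have h : HasDerivAt (fun t : ℝ => -z * (t : ℂ)) (-z) t := by
        simpa using (Complex.ofRealCLM.hasDerivAt (x := t)).const_mul (-z)
      exact h.cexp
    · intro t ht
      rw [norm_mul, norm_neg]
      refine mul_le_of_le_one_left (norm_nonneg _) ?_
      rw [Complex.norm_exp]
      simpa using mul_nonneg hz ht.1
  rcases le_total 1 r with h | h
  · rw [min_eq_left h, mul_one]; exact h2.trans (le_max_left _ _)
  · rw [min_eq_right h]
    exact h3.trans (mul_le_mul_of_nonneg_right (le_max_right _ _) hr)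

section Exponent

variable {α : Type*} [MeasurableSpace α] {μ : Measure α} {V : α → ℝ}

lemma integrable_cexp_neg_mul_sub_one (hV : Measurable V) (hV0 : ∀ a, 0 ≤ V a)
    (hint : Integrable (fun a => min 1 (V a)) μ) {z : ℂ} (hz : 0 ≤ z.re) :
    Integrable (fun a => Complex.exp (-z * V a) - 1) μ := by
  refine (hint.const_mul (max 2 ‖z‖)).mono' (by fun_prop) ?_
  exact Filter.Eventually.of_forall fun a => norm_cexp_neg_mul_sub_one_le hz (hV0 a)

/-- On `Re w > b = Re z / 2` the differentiated integrand is at most `V e^{-bV}`, which is dominated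
by a multiple of `min 1 V` because `bV + 1 ≤ e^{bV}`. On the imaginary axis this damping is lost,
and `V` itself need not be integrable. -/
lemma differentiableAt_integral_cexp_sub_one (hV : Measurable V) (hV0 : ∀ a, 0 ≤ V a)
    (hint : Integrable (fun a => min 1 (V a)) μ) {z : ℂ} (hz : 0 < z.re) :
    DifferentiableAt ℂ (fun z : ℂ => ∫ a, (Complex.exp (-z * V a) - 1) ∂μ) z := by
  set b : ℝ := z.re / 2 with hb
  have hb0 : 0 < b := by positivity
  have hs : {w : ℂ | b < w.re} ∈ nhds z :=
    (isOpen_lt continuous_const Complex.continuous_re).mem_nhds (by simp [hb]; linarith)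
  refine (hasDerivAt_integral_of_dominated_loc_of_deriv_le
    (F := fun (z : ℂ) a => Complex.exp (-z * V a) - 1)
    (F' := fun (z : ℂ) a => Complex.exp (-z * V a) * (-(V a : ℂ)))
    (bound := fun a => max 1 b⁻¹ * min 1 (V a)) hs
    (Filter.Eventually.of_forall fun w => by fun_prop)
    (integrable_cexp_neg_mul_sub_one hV hV0 hint hz.le) (by fun_prop) ?_
    (hint.const_mul _) ?_).2.differentiableAt
  · refine Filter.Eventually.of_forall fun a w hw => ?_
    have hr := hV0 a
    have h1 : ‖Complex.exp (-w * V a) * (-(V a : ℂ))‖ ≤ Real.exp (-(b * V a)) * V a := by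
      rw [norm_mul, Complex.norm_exp, norm_neg, Complex.norm_real, Real.norm_of_nonneg hr]
      gcongr
      simp only [Complex.mul_re, Complex.neg_re, Complex.ofReal_re,
        Complex.ofReal_im, mul_zero, sub_zero, neg_mul]
      exact neg_le_neg (mul_le_mul_of_nonneg_right (le_of_lt hw) hr)
    refine h1.trans ?_
    have h2 : Real.exp (-(b * V a)) ≤ 1 := by
      rw [Real.exp_le_one_iff]; have := mul_nonneg hb0.le hr; linarith
    have h3 : Real.exp (-(b * V a)) * V a ≤ b⁻¹ := by
      rw [Real.exp_neg, inv_mul_le_iff₀ (Real.exp_pos _), ← div_eq_mul_inv, le_div_iff₀ hb0]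
      have := Real.add_one_le_exp (b * V a)
      linarith
    rcases le_total 1 (V a) with h | h
    · rw [min_eq_left h, mul_one]; exact h3.trans (le_max_right _ _)
    · rw [min_eq_right h]
      exact mul_le_mul_of_nonneg_right (h2.trans (le_max_left _ _)) hr
  · refine Filter.Eventually.of_forall fun a w _ => ?_
    have h : HasDerivAt (fun w : ℂ => -w * (V a : ℂ)) (-(V a : ℂ)) w := by
      simpa using ((hasDerivAt_id w).neg.mul_const (V a : ℂ))
    exact h.cexp.sub_const 1

lemma continuousOn_integral_cexp_sub_one (hV : Measurable V) (hV0 : ∀ a, 0 ≤ V a)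
    (hint : Integrable (fun a => min 1 (V a)) μ) :
    ContinuousOn (fun z : ℂ => ∫ a, (Complex.exp (-z * V a) - 1) ∂μ) {z | 0 ≤ z.re} := by
  intro z _
  refine continuousWithinAt_of_dominated (bound := fun a => max 2 (‖z‖ + 1) * min 1 (V a))
    (Filter.Eventually.of_forall fun w => by fun_prop) ?_ (hint.const_mul _)
    (Filter.Eventually.of_forall fun a => by fun_prop)
  have h1 : ∀ᶠ w in nhdsWithin z {z : ℂ | 0 ≤ z.re}, ‖w‖ < ‖z‖ + 1 :=
    nhdsWithin_le_nhds ((isOpen_lt continuous_norm continuous_const).mem_nhds (by simp))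
  filter_upwards [h1, self_mem_nhdsWithin] with w hw hw0
  refine Filter.Eventually.of_forall fun a => (norm_cexp_neg_mul_sub_one_le hw0 (hV0 a)).trans ?_
  gcongr
  exact le_min zero_le_one (hV0 a)

lemma diffContOnCl_integral_cexp_sub_one (hV : Measurable V) (hV0 : ∀ a, 0 ≤ V a)
    (hint : Integrable (fun a => min 1 (V a)) μ) :
    DiffContOnCl ℂ (fun z : ℂ => ∫ a, (Complex.exp (-z * V a) - 1) ∂μ) {z | 0 < z.re} := by
  refine ⟨fun z hz => (differentiableAt_integral_cexp_sub_one hV hV0 hint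
    hz).differentiableWithinAt, ?_⟩
  rw [Complex.closure_setOfPred_lt_re]
  exact continuousOn_integral_cexp_sub_one hV hV0 hint

/-- The exponent has nonpositive real part, since `|e^{-zV}| ≤ 1` on the closed half-plane. -/
lemma norm_cexp_integral_cexp_sub_one_le (hV : Measurable V) (hV0 : ∀ a, 0 ≤ V a)
    (hint : Integrable (fun a => min 1 (V a)) μ) {z : ℂ} (hz : 0 ≤ z.re) {c : ℝ} (hc : 0 ≤ c) :
    ‖Complex.exp (c * ∫ a, (Complex.exp (-z * V a) - 1) ∂μ)‖ ≤ 1 := by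
  rw [Complex.norm_exp, Real.exp_le_one_iff, Complex.re_ofReal_mul]
  refine mul_nonpos_of_nonneg_of_nonpos hc ?_
  have := integral_re (𝕜 := ℂ) (integrable_cexp_neg_mul_sub_one hV hV0 hint hz)
  simp only [RCLike.re_to_complex] at this
  rw [← this]
  refine integral_nonpos fun a => ?_
  have h1 : (Complex.exp (-z * V a)).re ≤ 1 := by
    refine (Complex.re_le_norm _).trans ?_
    rw [Complex.norm_exp]
    simpa using mul_nonneg hz (hV0 a)
  simpa using h1

end Exponent

/-- A characteristic function of Lévy–Khintchine form on the imaginary axis extends to the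
Laplace transform. -/
theorem integral_exp_neg_mul_eq_of_charFun_eq {α β : Type*} [MeasurableSpace α]
    [MeasurableSpace β] {P : Measure α} [IsProbabilityMeasure P] {μ : Measure β}
    {V : α → ℝ} (hV : Measurable V) (hV0 : ∀ a, 0 ≤ V a)
    {W : β → ℝ} (hW : Measurable W) (hW0 : ∀ b, 0 ≤ W b)
    (hint : Integrable (fun b => min 1 (W b)) μ) {c : ℝ} (hc : 0 ≤ c)
    (h : ∀ t : ℝ, ∫ a, Complex.exp (t * V a * Complex.I) ∂P =
      Complex.exp (c * ∫ b, (Complex.exp (t * W b * Complex.I) - 1) ∂μ))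
    {u : ℝ} (hu : 0 ≤ u) :
    ∫ a, Real.exp (-u * V a) ∂P = Real.exp (-(c * ∫ b, (1 - Real.exp (-u * W b)) ∂μ)) := by
  have hintP : Integrable (fun a => min 1 (V a)) P := by
    refine (integrable_const (1 : ℝ)).mono' (by fun_prop)
      (Filter.Eventually.of_forall fun a => ?_)
    rw [Real.norm_of_nonneg (le_min zero_le_one (hV0 a))]
    exact min_le_left _ _
  -- The transform of `P` is written as `1 + ∫ (e^{-zV} - 1)` so that the same regularity lemmas
  -- serve both sides.
  set F : ℂ → ℂ := fun z => (1 + ∫ a, (Complex.exp (-z * V a) - 1) ∂P) -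
    Complex.exp (c * ∫ b, (Complex.exp (-z * W b) - 1) ∂μ) with hF
  have hFV : ∀ z : ℂ, 0 ≤ z.re →
      1 + ∫ a, (Complex.exp (-z * V a) - 1) ∂P = ∫ a, Complex.exp (-z * V a) ∂P := by
    intro z hz
    have hi := (integrable_cexp_neg_mul_sub_one hV hV0 hintP hz).add (integrable_const (1 : ℂ))
    have hi' : Integrable (fun a => Complex.exp (-z * V a)) P := by
      refine hi.congr (Filter.Eventually.of_forall fun a => by simp)
    rw [integral_sub hi' (integrable_const _)]
    simp
  have hbound : ∀ z : ℂ, 0 ≤ z.re → ‖F z‖ ≤ 2 := by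
    intro z hz
    have h1 : ‖∫ a, Complex.exp (-z * V a) ∂P‖ ≤ 1 := by
      refine (norm_integral_le_of_norm_le_const (C := 1)
        (Filter.Eventually.of_forall fun a => ?_)).trans (by simp)
      rw [Complex.norm_exp]
      simpa using mul_nonneg hz (hV0 a)
    have h2 := norm_cexp_integral_cexp_sub_one_le hW hW0 hint hz hc
    simp only [hF]
    rw [hFV z hz]
    exact (norm_sub_le _ _).trans (by linarith)
  have hd : DiffContOnCl ℂ F {z | 0 < z.re} := by
    refine DiffContOnCl.sub ((diffContOnCl_integral_cexp_sub_one hV hV0 hintP).const_add 1) ?_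
    have h1 : DiffContOnCl ℂ (fun z : ℂ => (c : ℂ) * ∫ b, (Complex.exp (-z * W b) - 1) ∂μ)
        {z | 0 < z.re} :=
      (diffContOnCl_integral_cexp_sub_one hW hW0 hint).const_smul (c : ℂ)
    exact Complex.differentiable_exp.comp_diffContOnCl h1
  have hzero : ∀ z : ℂ, 0 ≤ z.re → F z = 0 := by
    -- `F` is bounded, hence of growth order below 2 (order 1 with constant 0 is supplied), and
    -- vanishes on the imaginary axis by hypothesis.
    intro z hz
    have := PhragmenLindelof.right_half_plane_of_bounded_on_real (C := 0) hd
      ⟨1, by norm_num, 0, ?_⟩ ?_ ?_ hz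
    · simpa using this
    · refine Asymptotics.IsBigO.of_bound 2 ?_
      refine Filter.eventually_inf_principal.2 (Filter.Eventually.of_forall fun w hw => ?_)
      simpa using hbound w (le_of_lt hw)
    · refine ⟨2, ?_⟩
      rw [Filter.eventually_map]
      filter_upwards [Filter.eventually_ge_atTop 0] with x hx
      exact hbound x (by simpa using hx)
    · intro x
      have hx := h (-x)
      have e1 : ∀ y : ℝ, -((x : ℂ) * Complex.I) * y = ((-x : ℝ) : ℂ) * y * Complex.I := by
        intro y; push_cast; ring
      simp only [hF]
      rw [hFV _ (by simp)]
      simp only [e1, hx, sub_self, norm_zero, le_refl]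
  have hz := hzero u (by simpa using hu)
  simp only [hF] at hz
  rw [hFV _ (by simpa using hu), sub_eq_zero] at hz
  have e1 : ∀ y : ℝ, Complex.exp (-(u : ℂ) * y) = ((Real.exp (-u * y) : ℝ) : ℂ) := by
    intro y; push_cast; rfl
  have e2 : ∀ y : ℝ, ((Real.exp (-u * y) : ℝ) : ℂ) - 1 = ((Real.exp (-u * y) - 1 : ℝ) : ℂ) := by
    intro y; push_cast; rfl
  simp only [e1, e2] at hz
  rw [integral_complex_ofReal, integral_complex_ofReal, ← Complex.ofReal_mul,
    ← Complex.ofReal_exp, Complex.ofReal_inj] at hz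
  rw [hz, ← mul_neg, ← integral_neg]
  simp

/-! ### Exponentials on `[0, ∞]` and the Poisson generating function -/

/-- The map `x ↦ exp (-x)` on `[0, ∞]`, with `exp (-∞) = 0`. -/
def expNeg (x : ℝ≥0∞) : ℝ≥0∞ := EReal.exp (-(x : EReal))

lemma continuous_expNeg : Continuous expNeg :=
  ENNReal.continuous_exp.comp (continuous_neg.comp continuous_coe_ennreal_ereal)

@[fun_prop]
lemma measurable_expNeg : Measurable expNeg := continuous_expNeg.measurable

@[simp]
lemma expNeg_zero : expNeg 0 = 1 := by simp [expNeg]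

lemma expNeg_add (x y : ℝ≥0∞) : expNeg (x + y) = expNeg x * expNeg y := by
  rw [expNeg, expNeg, expNeg, ← EReal.exp_add, EReal.coe_ennreal_add, EReal.neg_add, sub_eq_add_neg]
  · exact Or.inl (EReal.coe_ennreal_ne_bot _)
  · exact Or.inr (EReal.coe_ennreal_ne_bot _)

lemma expNeg_sum {ι : Type*} (s : Finset ι) (f : ι → ℝ≥0∞) :
    expNeg (∑ i ∈ s, f i) = ∏ i ∈ s, expNeg (f i) := by
  classical
  induction s using Finset.induction_on with
  | empty => simp
  | insert i s hi ih => rw [Finset.sum_insert hi, Finset.prod_insert hi, expNeg_add, ih]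

lemma expNeg_natCast_mul (n : ℕ) (x : ℝ≥0∞) : expNeg (n * x) = expNeg x ^ n := by
  have := expNeg_sum (Finset.range n) (fun _ => x)
  simpa using this

lemma expNeg_le_one (x : ℝ≥0∞) : expNeg x ≤ 1 := by
  rw [expNeg, EReal.exp_le_one_iff, EReal.neg_le_zero]
  exact EReal.coe_ennreal_nonneg x

lemma expNeg_injective : Function.Injective expNeg := by
  intro x y h
  have := EReal.exp_strictMono.injective h
  simpa using this

lemma expNeg_ofReal {x : ℝ} (hx : 0 ≤ x) :
    expNeg (ENNReal.ofReal x) = ENNReal.ofReal (Real.exp (-x)) := by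
  rw [expNeg, EReal.coe_ennreal_ofReal, max_eq_left hx, ← EReal.coe_neg, EReal.exp_coe]

lemma expNeg_of_ne_top {x : ℝ≥0∞} (hx : x ≠ ∞) :
    expNeg x = ENNReal.ofReal (Real.exp (-x.toReal)) := by
  rw [← expNeg_ofReal ENNReal.toReal_nonneg, ENNReal.ofReal_toReal hx]

/-- The probability generating function of the Poisson distribution. -/
lemma lintegral_pow_poissonMeasure (r : ℝ≥0) {x : ℝ} (hx : 0 ≤ x) :
    ∫⁻ j, ENNReal.ofReal x ^ j ∂(poissonMeasure r) = ENNReal.ofReal (Real.exp (-(r * (1 - x)))) := by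
  rw [lintegral_countable']
  have h : ∀ j : ℕ, ENNReal.ofReal x ^ j * poissonMeasure r {j} =
      ENNReal.ofReal (Real.exp (-r) * ((r * x) ^ j / j.factorial)) := by
    intro j
    rw [poissonMeasure_singleton, ← ENNReal.ofReal_pow hx, ← ENNReal.ofReal_mul (by positivity)]
    congr 1
    rw [mul_pow]; ring
  have hs : HasSum (fun j : ℕ => Real.exp (-r) * ((r * x) ^ j / j.factorial))
      (Real.exp (-r) * Real.exp (r * x)) := by
    refine HasSum.mul_left _ ?_
    rw [Real.exp_eq_exp_ℝ]
    exact NormedSpace.expSeries_div_hasSum_exp _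
  rw [tsum_congr h, ← ENNReal.ofReal_tsum_of_nonneg (fun j => by positivity) hs.summable,
    hs.tsum_eq, ← Real.exp_add]
  congr 2
  ring

/-! ### Integrating out the counts given weights and atoms -/

section Conditional

variable {S : Type*} [MeasurableSpace S] {Θ : Type*} [MeasurableSpace Θ]
  {P : Measure Θ} {ν : Measure (ℝ≥0 × S)}
  {r : ℕ → Θ → ℝ≥0} {ω : ℕ → Θ → S} {n : ℕ → Θ → ℕ}

/-- The sigma-algebra generated by the weights and atoms. -/
abbrev weightAtomSigma (r : ℕ → Θ → ℝ≥0) (ω : ℕ → Θ → S) : MeasurableSpace Θ :=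
  MeasurableSpace.comap (fun θ k => (r k θ, ω k θ)) inferInstance

lemma IsCountMixtureModel.weightAtomSigma_le (h : IsCountMixtureModel P ν r ω n) :
    weightAtomSigma r ω ≤ ‹MeasurableSpace Θ› :=
  (measurable_pi_lambda _ fun k =>
    (h.measurable_weight k).prodMk (h.measurable_atom k)).comap_le

@[fun_prop]
lemma measurable_poissonMeasure_singleton (j : ℕ) :
    Measurable fun x : ℝ≥0 => poissonMeasure x {j} := by
  simp only [poissonMeasure_singleton]
  fun_prop

lemma IsCountMixtureModel.measurableSet_counts (h : IsCountMixtureModel P ν r ω n)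
    (s : Finset ℕ) (j : ℕ → ℕ) : MeasurableSet {θ | ∀ k ∈ s, n k θ = j k} := by
  have : {θ | ∀ k ∈ s, n k θ = j k} = ⋂ k ∈ s, n k ⁻¹' {j k} := by ext; simp
  rw [this]
  exact s.measurableSet_biInter fun k _ => h.measurable_count k (measurableSet_singleton _)

/-- Testing the conditional law on events of the weight-atom sigma-algebra says that two measures
agree after trimming to it; integrals of all nonnegative functions measurable for it then agree. -/
lemma IsCountMixtureModel.setLIntegral_counts [IsProbabilityMeasure P]
    (h : IsCountMixtureModel P ν r ω n)
    (s : Finset ℕ) (j : ℕ → ℕ) {g : Θ → ℝ≥0∞} (hg : Measurable[weightAtomSigma r ω] g) :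
    ∫⁻ θ in {θ | ∀ k ∈ s, n k θ = j k}, g θ ∂P =
      ∫⁻ θ, (∏ k ∈ s, poissonMeasure (r k θ) {j k}) * g θ ∂P := by
  have hle := h.weightAtomSigma_le
  have hE := h.measurableSet_counts s j
  have hmr := h.measurable_weight
  have hp : Measurable fun θ => ∏ k ∈ s, poissonMeasure (r k θ) {j k} := by fun_prop
  have hreal : ∀ θ, ENNReal.ofReal (∏ k ∈ s, (poissonMeasure (r k θ)).real {j k}) =
      ∏ k ∈ s, poissonMeasure (r k θ) {j k} := fun θ => by
    rw [ENNReal.ofReal_prod_of_nonneg fun _ _ => measureReal_nonneg]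
    simp
  have htrim : (P.restrict {θ | ∀ k ∈ s, n k θ = j k}).trim hle =
      (P.withDensity fun θ => ∏ k ∈ s, poissonMeasure (r k θ) {j k}).trim hle := by
    refine @Measure.ext _ (weightAtomSigma r ω) _ _ fun C hC => ?_
    rw [trim_measurableSet_eq hle hC, trim_measurableSet_eq hle hC,
      Measure.restrict_apply (hle _ hC), withDensity_apply _ (hle _ hC)]
    have hint : Integrable ({θ | ∀ k ∈ s, n k θ = j k}.indicator fun _ => (1 : ℝ)) P :=
      (integrable_const 1).indicator hE
    have h1 := setIntegral_condExp hle hint hC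
    have h2 : ∫ θ in C, (P[{θ | ∀ k ∈ s, n k θ = j k}.indicator (fun _ => (1 : ℝ)) |
        weightAtomSigma r ω]) θ ∂P = ∫ θ in C, ∏ k ∈ s, (poissonMeasure (r k θ)).real {j k} ∂P :=
      integral_congr_ae (ae_restrict_of_ae (h.count_condLaw s j))
    have hpint : Integrable (fun θ => ∏ k ∈ s, (poissonMeasure (r k θ)).real {j k}) P :=
      integrable_condExp.congr (h.count_condLaw s j)
    rw [h2, integral_indicator hE, Measure.restrict_restrict hE] at h1
    simp only [integral_const, MeasurableSet.univ, measureReal_restrict_apply, Set.univ_inter,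
      smul_eq_mul, mul_one] at h1
    rw [Set.inter_comm, ← ENNReal.ofReal_toReal (measure_ne_top P _), ← measureReal_def, ← h1,
      ofReal_integral_eq_lintegral_ofReal hpint.integrableOn]
    · simp only [hreal]
    · exact Filter.Eventually.of_forall fun θ => Finset.prod_nonneg fun _ _ => measureReal_nonneg
  rw [← lintegral_trim hle hg, htrim, lintegral_trim hle hg,
    lintegral_withDensity_eq_lintegral_mul _ hp (hg.mono hle le_rfl)]
  rfl

/-- Integrating out the first `N` counts given the weights and the atoms. -/
lemma IsCountMixtureModel.lintegral_prod_counts [IsProbabilityMeasure P]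
    (h : IsCountMixtureModel P ν r ω n)
    (N : ℕ) {g : ℕ → S → ℝ≥0∞} (hg : ∀ j, Measurable (g j)) :
    ∫⁻ θ, ∏ k : Fin N, g (n k θ) (ω k θ) ∂P =
      ∫⁻ θ, ∏ k : Fin N, ∫⁻ j, g j (ω k θ) ∂(poissonMeasure (r k θ)) ∂P := by
  have hle := h.weightAtomSigma_le
  have hmr := h.measurable_weight
  have hmω : ∀ k, Measurable[weightAtomSigma r ω] (ω k) := by
    intro k
    have h1 : Measurable[weightAtomSigma r ω] fun θ k => (r k θ, ω k θ) := comap_measurable _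
    exact measurable_snd.comp ((measurable_pi_apply k).comp h1)
  -- The padding by 0 is immaterial: only indices below `N` enter the event.
  let ext : (Fin N → ℕ) → ℕ → ℕ := fun j k => if hk : k < N then j ⟨k, hk⟩ else 0
  have hset : ∀ j : Fin N → ℕ, {θ | ∀ k ∈ Finset.range N, n k θ = ext j k} =
      (fun θ (k : Fin N) => n k θ) ⁻¹' {j} := by
    intro j
    ext θ
    simp only [Finset.mem_range, Set.mem_ofPred_eq, Set.mem_preimage, Set.mem_singleton_iff, ext]
    constructor
    · intro H; funext k; rw [H k k.2, dif_pos k.2]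
    · intro H k hk; rw [dif_pos hk, ← H]
  have hmn : Measurable fun θ (k : Fin N) => n k θ :=
    measurable_pi_lambda _ fun k => h.measurable_count k
  have hleft : ∫⁻ θ, ∏ k : Fin N, g (n k θ) (ω k θ) ∂P =
      ∑' j : Fin N → ℕ, ∫⁻ θ in {θ | ∀ k ∈ Finset.range N, n k θ = ext j k},
        ∏ k : Fin N, g (j k) (ω k θ) ∂P := by
    have hU : (⋃ j : Fin N → ℕ, (fun θ (k : Fin N) => n k θ) ⁻¹' {j}) = Set.univ := by
      ext θ; simp
    rw [← setLIntegral_univ, ← hU, lintegral_iUnion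
      (fun j => hmn (measurableSet_singleton j))]
    · refine tsum_congr fun j => ?_
      rw [hset]
      refine setLIntegral_congr_fun (hmn (measurableSet_singleton j)) fun θ hθ => ?_
      have : (fun k : Fin N => n k θ) = j := hθ
      simp only [← this]
    · intro i j hij
      exact Disjoint.preimage _ (by simpa using hij)
  have hterm : ∀ j : Fin N → ℕ, ∫⁻ θ in {θ | ∀ k ∈ Finset.range N, n k θ = ext j k},
        ∏ k : Fin N, g (j k) (ω k θ) ∂P =
      ∫⁻ θ, ∏ k : Fin N, (g (j k) (ω k θ) * poissonMeasure (r k θ) {j k}) ∂P := by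
    intro j
    rw [h.setLIntegral_counts]
    · refine lintegral_congr fun θ => ?_
      rw [Finset.prod_range, Finset.prod_mul_distrib, mul_comm]
      congr 1
      refine Finset.prod_congr rfl fun k _ => ?_
      simp [ext]
    · exact Finset.measurable_prod _ fun k _ => (hg (j k)).comp (hmω k)
  rw [hleft, tsum_congr hterm, ← lintegral_tsum]
  · refine lintegral_congr fun θ => ?_
    -- For fixed `θ` the sum over count tuples is an integral against the product of the laws
    -- `Pois(r_k)`, under which the coordinates are independent and the integral factors.
    have hind := iIndepFun_pi (μ := fun k : Fin N => poissonMeasure (r k θ))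
      (X := fun (k : Fin N) j => g j (ω k θ)) fun k => (Measurable.of_discrete).aemeasurable
    have hprod := lintegral_prod_eq_prod_lintegral_of_indepFun Finset.univ _ hind
      fun k => Measurable.of_discrete
    have hev : ∀ k : Fin N, ∫⁻ y : Fin N → ℕ, g (y k) (ω k θ)
        ∂(Measure.pi fun k : Fin N => poissonMeasure (r k θ)) =
        ∫⁻ j, g j (ω k θ) ∂(poissonMeasure (r k θ)) := fun k =>
      (measurePreserving_eval (fun k : Fin N => poissonMeasure (r k θ)) k).lintegral_comp
        (f := fun j => g j (ω k θ)) Measurable.of_discrete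
    rw [← Finset.prod_congr rfl fun k _ => hev k, ← hprod, lintegral_countable']
    refine tsum_congr fun j => ?_
    rw [Measure.pi_singleton, Finset.prod_mul_distrib]
  · intro j
    refine (Finset.measurable_prod _ fun k _ => ?_).aemeasurable
    refine ((hg (j k)).comp (h.measurable_atom k)).mul ?_
    fun_prop

end Conditional

lemma lintegral_atomic {S : Type*} [MeasurableSpace S] (w : ℕ → ℝ≥0∞) (x : ℕ → S)
    {g : S → ℝ≥0∞} (hg : Measurable g) : ∫⁻ s, g s ∂(atomic w x) = ∑' k, w k * g (x k) := by
  rw [atomic, lintegral_sum_measure]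
  refine tsum_congr fun k => ?_
  rw [lintegral_smul_measure, lintegral_dirac' _ hg, smul_eq_mul]

lemma expNeg_natCast (j : ℕ) : expNeg j = ENNReal.ofReal (Real.exp (-j)) := by
  rw [← expNeg_ofReal (Nat.cast_nonneg j), ENNReal.ofReal_natCast]

/-- Dominated convergence with bound 1. Continuity of `expNeg` at `∞` makes finiteness of the series
unnecessary. -/
lemma tendsto_lintegral_prod_expNeg {α : Type*} [MeasurableSpace α] (P : Measure α)
    [IsProbabilityMeasure P] {V : ℕ → α → ℝ≥0∞} (hV : ∀ k, Measurable (V k)) :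
    Filter.Tendsto (fun N => ∫⁻ a, ∏ k : Fin N, expNeg (V k a) ∂P) Filter.atTop
      (nhds (∫⁻ a, expNeg (∑' k, V k a) ∂P)) := by
  have heq : ∀ N a, ∏ k : Fin N, expNeg (V k a) = expNeg (∑ k ∈ Finset.range N, V k a) := by
    intro N a
    rw [expNeg_sum, Finset.prod_range]
  simp only [heq]
  refine tendsto_lintegral_of_dominated_convergence (fun _ => 1) (fun N => by fun_prop)
    (fun N => Filter.Eventually.of_forall fun a => expNeg_le_one _) (by simp)
    (Filter.Eventually.of_forall fun a => ?_)
  exact (continuous_expNeg.tendsto _).comp ENNReal.summable.hasSum.tendsto_sum_nat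

/-- The Laplace functional of the counts in terms of that of the weights. -/
theorem IsCountMixtureModel.lintegral_expNeg_countMeasure {S : Type*} [MeasurableSpace S]
    {Θ : Type*} [MeasurableSpace Θ] {P : Measure Θ} [IsProbabilityMeasure P]
    {ν : Measure (ℝ≥0 × S)} {r : ℕ → Θ → ℝ≥0} {ω : ℕ → Θ → S} {n : ℕ → Θ → ℕ}
    (h : IsCountMixtureModel P ν r ω n) {f : S → ℕ} (hf : Measurable f) :
    ∫⁻ θ, expNeg (∫⁻ s, f s ∂(countMeasure ω n θ)) ∂P =
      ∫⁻ θ, expNeg (∫⁻ s, ENNReal.ofReal (1 - Real.exp (-(f s : ℝ)))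
        ∂(atomic (fun k => (r k θ : ℝ≥0∞)) (fun k => ω k θ))) ∂P := by
  have hmr := h.measurable_weight
  have hmω := h.measurable_atom
  have hmn := h.measurable_count
  have hf' : Measurable fun s => (f s : ℝ≥0∞) := Measurable.of_discrete.comp hf
  have hfr : Measurable fun s => ENNReal.ofReal (1 - Real.exp (-(f s : ℝ))) :=
    (Measurable.of_discrete (f := fun j : ℕ => ENNReal.ofReal (1 - Real.exp (-(j : ℝ))))).comp hf
  have hmn' : ∀ k, Measurable fun θ => (n k θ : ℝ≥0∞) := fun k =>
    Measurable.of_discrete.comp (hmn k)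
  simp only [countMeasure, lintegral_atomic _ _ hf', lintegral_atomic _ _ hfr]
  have h1 := tendsto_lintegral_prod_expNeg P (V := fun k θ => (n k θ : ℝ≥0∞) * f (ω k θ))
    fun k => (hmn' k).mul (hf'.comp (hmω k))
  have h2 := tendsto_lintegral_prod_expNeg P
    (V := fun k θ => (r k θ : ℝ≥0∞) * ENNReal.ofReal (1 - Real.exp (-(f (ω k θ) : ℝ))))
    fun k => (hmr k).coe_nnreal_ennreal.mul (hfr.comp (hmω k))
  refine tendsto_nhds_unique h1 (h2.congr fun N => ?_)
  have h3 := h.lintegral_prod_counts N (g := fun j s => expNeg (j * f s)) fun j => by fun_prop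
  rw [h3]
  refine lintegral_congr fun θ => Finset.prod_congr rfl fun k _ => ?_
  simp only [expNeg_natCast_mul, expNeg_natCast]
  have h0 : (0 : ℝ) ≤ 1 - Real.exp (-(f (ω k θ) : ℝ)) := by simp
  rw [lintegral_pow_poissonMeasure _ (Real.exp_pos _).le, ← expNeg_ofReal (by positivity),
    ENNReal.ofReal_mul (by positivity), ENNReal.ofReal_coe_nnreal]

/-! ### Laplace functionals of the weights and of the counts -/

/-- The Laplace exponent of a Lévy measure. -/
def laplaceExponent (ρ : Measure ℝ≥0) (c : ℝ) : ℝ := ∫ x : ℝ≥0, (1 - Real.exp (-c * x)) ∂ρ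

/-- The integrands depend on the jump size alone, so integrals over `ℝ₊ × A` collapse to integrals
against `ρ` scaled by `G₀ A`. -/
lemma map_fst_restrict_prod {α S : Type*} [MeasurableSpace α] [MeasurableSpace S] (ρ : Measure α)
    (G₀ : Measure S) [SFinite G₀] {A : Set S} (hA : MeasurableSet A) :
    ((ρ.prod G₀).restrict (Set.univ ×ˢ A)).map Prod.fst = G₀ A • ρ := by
  ext B hB
  rw [Measure.map_apply measurable_fst hB, Measure.restrict_apply (measurable_fst hB)]
  have : Prod.fst ⁻¹' B ∩ Set.univ ×ˢ A = B ×ˢ A := by ext; simp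
  rw [this, Measure.prod_apply (hB.prod hA), Measure.smul_apply, smul_eq_mul]
  have : ∀ x, G₀ (Prod.mk x ⁻¹' B ×ˢ A) = B.indicator (fun _ => G₀ A) x := by
    intro x
    by_cases hx : x ∈ B <;> simp [hx]
  simp only [this, lintegral_indicator hB, setLIntegral_const]

/-- Integrability of `min 1 r` under the intensity of the weights. -/
lemma IsLevyMeasure.integrable_min {S : Type*} [MeasurableSpace S] {ρ : Measure ℝ≥0}
    {G₀ : Measure S} [IsFiniteMeasure G₀] (hG₀ : G₀ ≠ 0) (hν : IsLevyMeasure (ρ.prod G₀)) :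
    Integrable (fun x : ℝ≥0 => min 1 (x : ℝ)) ρ := by
  have h := hν Set.univ MeasurableSet.univ
  have h1 : ∫⁻ p in Set.univ ×ˢ Set.univ, min 1 (p.1 : ℝ≥0∞) ∂(ρ.prod G₀) =
      G₀ Set.univ * ∫⁻ x : ℝ≥0, min 1 (x : ℝ≥0∞) ∂ρ := by
    rw [← smul_eq_mul, ← lintegral_smul_measure, ← map_fst_restrict_prod ρ G₀ MeasurableSet.univ,
      lintegral_map (by fun_prop) measurable_fst]
  rw [h1] at h
  have h2 : ∫⁻ x : ℝ≥0, min 1 (x : ℝ≥0∞) ∂ρ < ∞ :=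
    ENNReal.lt_top_of_mul_ne_top_right h.ne (by simpa using hG₀)
  refine ⟨by fun_prop, ?_⟩
  rw [hasFiniteIntegral_iff_ofReal (Filter.Eventually.of_forall fun x => by positivity)]
  convert h2 using 3 with x
  rw [ENNReal.ofReal_min]
  simp

/-- The Laplace transform of the mass of a set under a completely random measure. -/
lemma IsCompletelyRandomMeasure.lintegral_expNeg {S : Type*} [MeasurableSpace S] {Θ : Type*}
    [MeasurableSpace Θ] {P : Measure Θ} [IsProbabilityMeasure P] {G : Θ → Measure S}
    {ρ : Measure ℝ≥0} {G₀ : Measure S} [IsFiniteMeasure G₀]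
    (h : IsCompletelyRandomMeasure P G (ρ.prod G₀))
    (hρ : Integrable (fun x : ℝ≥0 => min 1 (x : ℝ)) ρ) {A : Set S} (hA : MeasurableSet A)
    {c : ℝ} (hc : 0 ≤ c) :
    ∫⁻ θ, expNeg (ENNReal.ofReal c * G θ A) ∂P =
      ENNReal.ofReal (Real.exp (-(G₀.real A * laplaceExponent ρ c))) := by
  have hGA : Measurable fun θ => G θ A := (Measure.measurable_coe hA).comp h.measurable
  have hGA' : Measurable fun θ => (G θ).real A := hGA.ennreal_toReal
  have key := integral_exp_neg_mul_eq_of_charFun_eq (P := P) (μ := ρ)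
    (V := fun θ => (G θ).real A) (W := fun x : ℝ≥0 => (x : ℝ)) hGA' (fun _ => measureReal_nonneg)
    (by fun_prop) (fun x => x.2) hρ (c := G₀.real A) measureReal_nonneg ?_ hc
  · rw [laplaceExponent, ← key, ofReal_integral_eq_lintegral_ofReal]
    · refine lintegral_congr_ae ?_
      filter_upwards [h.finite A hA] with θ hθ
      rw [expNeg_of_ne_top (ENNReal.mul_ne_top ENNReal.ofReal_ne_top hθ.ne), ENNReal.toReal_mul,
        ENNReal.toReal_ofReal hc, neg_mul, measureReal_def]
    · refine (integrable_const (1 : ℝ)).mono'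
        (Real.measurable_exp.comp (hGA'.const_mul (-c))).aestronglyMeasurable
        (Filter.Eventually.of_forall fun θ => ?_)
      rw [Real.norm_of_nonneg (Real.exp_pos _).le, Real.exp_le_one_iff, neg_mul, neg_nonpos]
      exact mul_nonneg hc measureReal_nonneg
    · exact Filter.Eventually.of_forall fun θ => (Real.exp_pos _).le
  · intro t
    rw [h.charFun_eq A hA t]
    congr 1
    rw [← integral_map (φ := Prod.fst) (f := fun x : ℝ≥0 =>
      Complex.exp (t * (x : ℝ) * Complex.I) - 1) measurable_fst.aemeasurable (by fun_prop),
      map_fst_restrict_prod ρ G₀ hA, integral_smul_measure, measureReal_def, Complex.real_smul]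

lemma lintegral_ofReal_comp_nat {S : Type*} [MeasurableSpace S] {μ : Measure S} {f : S → ℕ}
    (hf : Measurable f) {M : ℕ} (hM : ∀ s, f s < M) {c : ℕ → ℝ} :
    ∫⁻ s, ENNReal.ofReal (c (f s)) ∂μ =
      ∑ j ∈ Finset.range M, ENNReal.ofReal (c j) * μ (f ⁻¹' {j}) := by
  have hB : ∀ j, MeasurableSet (f ⁻¹' {j}) := fun j => hf (measurableSet_singleton j)
  have h1 : ∀ s, ENNReal.ofReal (c (f s)) = ∑ j ∈ Finset.range M,
      (f ⁻¹' {j}).indicator (fun _ => ENNReal.ofReal (c j)) s := by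
    intro s
    rw [Finset.sum_eq_single (f s)]
    · simp
    · intro j _ hj
      simp [Ne.symm hj]
    · intro hs
      exact absurd (Finset.mem_range.2 (hM s)) hs
  simp only [h1]
  rw [lintegral_finsetSum _ fun j _ => measurable_const.indicator (hB j)]
  refine Finset.sum_congr rfl fun j _ => ?_
  rw [lintegral_indicator (hB j), setLIntegral_const]

/-- The Laplace functional of a completely random measure on simple functions. -/
lemma IsCompletelyRandomMeasure.lintegral_expNeg_lintegral {S : Type*} [MeasurableSpace S]
    {Θ : Type*} [MeasurableSpace Θ] {P : Measure Θ} [IsProbabilityMeasure P] {G : Θ → Measure S}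
    {ρ : Measure ℝ≥0} {G₀ : Measure S} [IsFiniteMeasure G₀]
    (h : IsCompletelyRandomMeasure P G (ρ.prod G₀))
    (hρ : Integrable (fun x : ℝ≥0 => min 1 (x : ℝ)) ρ) {f : S → ℕ} (hf : Measurable f)
    {M : ℕ} (hM : ∀ s, f s < M) {c : ℕ → ℝ} (hc : ∀ j, 0 ≤ c j) :
    ∫⁻ θ, expNeg (∫⁻ s, ENNReal.ofReal (c (f s)) ∂(G θ)) ∂P =
      ENNReal.ofReal (Real.exp (-∑ j ∈ Finset.range M,
        G₀.real (f ⁻¹' {j}) * laplaceExponent ρ (c j))) := by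
  have hB : ∀ j, MeasurableSet (f ⁻¹' {j}) := fun j => hf (measurableSet_singleton j)
  -- The level sets of `f` are pairwise disjoint, so the masses they receive are independent.
  have hind : iIndepFun (fun j θ => expNeg (ENNReal.ofReal (c j) * G θ (f ⁻¹' {j}))) P :=
    (h.indep (fun j => f ⁻¹' {j}) hB fun i j hij => Disjoint.preimage _ (by simpa using hij)).comp
      (fun j x => expNeg (ENNReal.ofReal (c j) * x)) fun j => by fun_prop
  have hmeas : ∀ j, Measurable fun θ => G θ (f ⁻¹' {j}) := fun j =>
    (Measure.measurable_coe (hB j)).comp h.measurable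
  simp only [lintegral_ofReal_comp_nat hf hM, expNeg_sum]
  rw [lintegral_prod_eq_prod_lintegral_of_indepFun _ _ hind fun j => by fun_prop,
    ← Finset.sum_neg_distrib, Real.exp_sum, ENNReal.ofReal_prod_of_nonneg
      fun j _ => (Real.exp_pos _).le]
  exact Finset.prod_congr rfl fun j _ => h.lintegral_expNeg hρ (hB j) (hc j)

/-- The Laplace functional of the count measure on simple functions. -/
theorem IsCountMixtureModel.lintegral_expNeg_eq {S : Type*} [MeasurableSpace S]
    {Θ : Type*} [MeasurableSpace Θ] {P : Measure Θ} [IsProbabilityMeasure P]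
    {ρ : Measure ℝ≥0} {G₀ : Measure S} [IsFiniteMeasure G₀]
    {r : ℕ → Θ → ℝ≥0} {ω : ℕ → Θ → S} {n : ℕ → Θ → ℕ}
    (h : IsCountMixtureModel P (ρ.prod G₀) r ω n)
    (hρ : Integrable (fun x : ℝ≥0 => min 1 (x : ℝ)) ρ) {f : S → ℕ} (hf : Measurable f)
    {M : ℕ} (hM : ∀ s, f s < M) :
    ∫⁻ θ, expNeg (∫⁻ s, f s ∂(countMeasure ω n θ)) ∂P =
      ENNReal.ofReal (Real.exp (-∑ j ∈ Finset.range M,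
        G₀.real (f ⁻¹' {j}) * laplaceExponent ρ (1 - Real.exp (-j)))) := by
  rw [h.lintegral_expNeg_countMeasure hf]
  exact h.isCRM.lintegral_expNeg_lintegral hρ hf hM (c := fun j => 1 - Real.exp (-(j : ℝ)))
    fun j => by simp

/-! ### The cluster size law and its generating function -/

section Sizes

variable {ρ : Measure ℝ≥0}

lemma integrable_one_sub_exp (hρ : Integrable (fun x : ℝ≥0 => min 1 (x : ℝ)) ρ) {c : ℝ}
    (hc : 0 ≤ c) : Integrable (fun x : ℝ≥0 => 1 - Real.exp (-c * x)) ρ := by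
  refine (hρ.const_mul (max 1 c)).mono' (by fun_prop) (Filter.Eventually.of_forall fun x => ?_)
  have hx : (0 : ℝ) ≤ x := x.coe_nonneg
  have h1 : Real.exp (-c * x) ≤ 1 := by
    rw [Real.exp_le_one_iff, neg_mul, neg_nonpos]; positivity
  have h2 := Real.add_one_le_exp (-c * x)
  have h3 := Real.exp_pos (-c * x)
  rw [Real.norm_of_nonneg (by linarith)]
  rcases le_total 1 (x : ℝ) with h | h
  · rw [min_eq_left h, mul_one]; exact le_trans (by linarith) (le_max_left _ _)
  · rw [min_eq_right h]
    exact le_trans (by linarith) (mul_le_mul_of_nonneg_right (le_max_right 1 c) hx)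

/-- The dominating function is `j! min(1, x)`: for `x ≥ 1` the exponential series gives `x^j ≤ j!
e^x`, and for `x ≤ 1` one has `x^j ≤ x` because `j ≥ 1`. -/
lemma integrable_pow_mul_exp (hρ : Integrable (fun x : ℝ≥0 => min 1 (x : ℝ)) ρ) {j : ℕ}
    (hj : 1 ≤ j) : Integrable (fun x : ℝ≥0 => (x : ℝ) ^ j * Real.exp (-x)) ρ := by
  refine (hρ.const_mul (j.factorial : ℝ)).mono' (by fun_prop)
    (Filter.Eventually.of_forall fun x => ?_)
  have hx : (0 : ℝ) ≤ x := x.coe_nonneg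
  have hj1 : (1 : ℝ) ≤ j.factorial := by exact_mod_cast j.factorial_pos
  rw [Real.norm_of_nonneg (by positivity)]
  rcases le_total 1 (x : ℝ) with h | h
  · rw [min_eq_left h, mul_one, Real.exp_neg, ← div_eq_mul_inv, div_le_iff₀ (Real.exp_pos _)]
    have := Real.pow_div_factorial_le_exp (x : ℝ) hx j
    rw [div_le_iff₀ (by positivity)] at this
    linarith
  · rw [min_eq_right h]
    calc (x : ℝ) ^ j * Real.exp (-x) ≤ x * 1 := by
          gcongr
          · exact pow_le_of_le_one hx h (by omega)
          · simp
      _ ≤ j.factorial * x := by nlinarith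

lemma integral_one_sub_exp_pos (hρ : Integrable (fun x : ℝ≥0 => min 1 (x : ℝ)) ρ)
    (h0 : ρ {0}ᶜ ≠ 0) : 0 < ∫ x : ℝ≥0, (1 - Real.exp (-x)) ∂ρ := by
  have hi : Integrable (fun x : ℝ≥0 => 1 - Real.exp (-x)) ρ := by
    simpa using integrable_one_sub_exp hρ zero_le_one
  rw [integral_pos_iff_support_of_nonneg (fun x => by simp) hi]
  have : Function.support (fun x : ℝ≥0 => 1 - Real.exp (-x)) = {0}ᶜ := by
    ext x
    rw [Function.mem_support, sub_ne_zero, ne_comm, Ne, Real.exp_eq_one_iff]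
    simp
  rw [this]
  exact pos_iff_ne_zero.2 h0

/-- The probability generating function of the cluster size law. -/
lemma lintegral_pow_sizeLaw (hρ : Integrable (fun x : ℝ≥0 => min 1 (x : ℝ)) ρ)
    (h0 : ρ {0}ᶜ ≠ 0) {y : ℝ} (hy : 0 ≤ y) (hy1 : y ≤ 1) :
    ∫⁻ j, ENNReal.ofReal y ^ j ∂(sizeLaw ρ) = ENNReal.ofReal
      (1 - laplaceExponent ρ (1 - y) / ∫ x : ℝ≥0, (1 - Real.exp (-x)) ∂ρ) := by
  have hψ := integral_one_sub_exp_pos hρ h0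
  set ψ := ∫ x : ℝ≥0, (1 - Real.exp (-x)) ∂ρ with hψdef
  have hi1 : Integrable (fun x : ℝ≥0 => 1 - Real.exp (-x)) ρ := by
    simpa using integrable_one_sub_exp hρ zero_le_one
  have hi2 := integrable_one_sub_exp hρ (c := 1 - y) (by linarith)
  -- Differences of integrable exponents are kept throughout: `ρ` may have infinite mass near 0, so
  -- `e^{-x}` alone need not be integrable.
  have hi12 : Integrable (fun x : ℝ≥0 =>
      (1 - Real.exp (-x)) - (1 - Real.exp (-(1 - y) * x))) ρ := hi1.sub hi2
  have hterm : ∀ i : ℕ, ENNReal.ofReal (sizeProb ρ (i + 1)) * ENNReal.ofReal y ^ (i + 1) =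
      ENNReal.ofReal ψ⁻¹ * ∫⁻ x : ℝ≥0, ENNReal.ofReal
        (Real.exp (-x) * ((x * y) ^ (i + 1) / (i + 1).factorial)) ∂ρ := by
    intro i
    have hi := (integrable_pow_mul_exp hρ (j := i + 1) (by omega)).const_mul
      (y ^ (i + 1) / (i + 1).factorial)
    have e : ∀ x : ℝ≥0, Real.exp (-x) * ((x * y) ^ (i + 1) / (i + 1).factorial) =
        y ^ (i + 1) / (i + 1).factorial * ((x : ℝ) ^ (i + 1) * Real.exp (-x)) := by
      intro x; rw [mul_pow]; ring
    simp only [e]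
    rw [← ofReal_integral_eq_lintegral_ofReal hi
      (Filter.Eventually.of_forall fun x => by positivity), ← ENNReal.ofReal_mul (by positivity),
      ← ENNReal.ofReal_pow hy, ← ENNReal.ofReal_mul' (by positivity), integral_const_mul, sizeProb, ← hψdef]
    congr 1
    field_simp
  -- The Poisson series without its term at 0 sums to `e^{-x}(e^{xy} - 1)`.
  have hpt : ∀ x : ℝ≥0, ∑' i : ℕ, ENNReal.ofReal
      (Real.exp (-x) * ((x * y) ^ (i + 1) / (i + 1).factorial)) =
      ENNReal.ofReal ((1 - Real.exp (-x)) - (1 - Real.exp (-(1 - y) * x))) := by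
    intro x
    have hs : HasSum (fun j : ℕ => (x * y) ^ j / (j.factorial : ℝ)) (Real.exp (x * y)) := by
      rw [Real.exp_eq_exp_ℝ]
      exact NormedSpace.expSeries_div_hasSum_exp _
    have hs' := ((hasSum_nat_add_iff' 1).2 hs).mul_left (Real.exp (-x))
    rw [← ENNReal.ofReal_tsum_of_nonneg (fun i => by positivity) hs'.summable, hs'.tsum_eq]
    congr 1
    simp only [Finset.range_one, Finset.sum_singleton, pow_zero, Nat.factorial_zero, Nat.cast_one,
      div_one, mul_sub, mul_one, ← Real.exp_add]
    rw [show -(1 - y) * (x : ℝ) = -x + x * y by ring]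
    ring
  rw [sizeLaw, lintegral_sum_measure]
  simp only [lintegral_smul_measure, lintegral_dirac, smul_eq_mul]
  rw [tsum_congr hterm, ENNReal.tsum_mul_left, ← lintegral_tsum fun i => by fun_prop,
    lintegral_congr hpt, ← ofReal_integral_eq_lintegral_ofReal hi12,
    ← ENNReal.ofReal_mul (by positivity), integral_sub hi1 hi2, ← hψdef, laplaceExponent]
  · congr 1
    field_simp
  · refine Filter.Eventually.of_forall fun x => ?_
    have : Real.exp (-x) ≤ Real.exp (-(1 - y) * x) := by
      rw [Real.exp_le_exp]
      have := mul_nonneg hy x.coe_nonneg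
      linarith
    simp only [Pi.zero_apply]
    linarith

/-- The total mass is the generating function at `y = 1`, where the Laplace exponent vanishes. -/
lemma isProbabilityMeasure_sizeLaw (hρ : Integrable (fun x : ℝ≥0 => min 1 (x : ℝ)) ρ)
    (h0 : ρ {0}ᶜ ≠ 0) : IsProbabilityMeasure (sizeLaw ρ) := by
  constructor
  have := lintegral_pow_sizeLaw hρ h0 zero_le_one le_rfl
  simpa [laplaceExponent] using this

lemma sizeLaw_singleton_zero : sizeLaw ρ {0} = 0 := by
  simp [sizeLaw, Measure.sum_apply]

/-- This keeps the values `1 - Φ(c)/ψ` nonnegative, so that `ENNReal.ofReal` does not truncate them.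
-/
lemma laplaceExponent_le (hρ : Integrable (fun x : ℝ≥0 => min 1 (x : ℝ)) ρ) {c : ℝ}
    (hc : 0 ≤ c) (hc1 : c ≤ 1) :
    laplaceExponent ρ c ≤ ∫ x : ℝ≥0, (1 - Real.exp (-x)) ∂ρ := by
  have hi1 : Integrable (fun x : ℝ≥0 => 1 - Real.exp (-x)) ρ := by
    simpa using integrable_one_sub_exp hρ zero_le_one
  refine integral_mono (integrable_one_sub_exp hρ hc) hi1 fun x => ?_
  have h := mul_le_mul_of_nonneg_right hc1 x.coe_nonneg
  simp only [neg_mul]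
  gcongr
  linarith

end Sizes

/-! ### The compound Poisson process on its canonical space -/

lemma isProbabilityMeasure_baseLaw {S : Type*} [MeasurableSpace S] {G₀ : Measure S}
    [IsFiniteMeasure G₀] (hG₀ : G₀ ≠ 0) : IsProbabilityMeasure (baseLaw G₀) := by
  constructor
  rw [baseLaw, Measure.smul_apply, smul_eq_mul]
  exact ENNReal.inv_mul_cancel (by simpa using hG₀) (measure_ne_top _ _)

/-- The compound Poisson sample space: the number of clusters, their sizes and locations. -/
def compoundLaw {S : Type*} [MeasurableSpace S] (lam : ℝ≥0) (q : Measure ℕ) (g : Measure S) :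
    Measure (ℕ × (ℕ → ℕ × S)) :=
  (poissonMeasure lam).prod (Measure.infinitePi fun _ => q.prod g)

/-- The compound Poisson random measure on its sample space. -/
def compoundMeasure {S : Type*} [MeasurableSpace S] (x : ℕ × (ℕ → ℕ × S)) : Measure S :=
  ∑ k ∈ Finset.range x.1, ((x.2 k).1 : ℝ≥0∞) • Measure.dirac (x.2 k).2

lemma compoundMeasure_apply {S : Type*} [MeasurableSpace S] (x : ℕ × (ℕ → ℕ × S)) {A : Set S}
    (hA : MeasurableSet A) :
    compoundMeasure x A = ∑ k ∈ Finset.range x.1, ((x.2 k).1 : ℝ≥0∞) *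
      A.indicator (fun _ => 1) (x.2 k).2 := by
  simp only [compoundMeasure, Measure.coe_finsetSum, Finset.sum_apply, Measure.smul_apply,
    Measure.dirac_apply' _ hA, smul_eq_mul]
  rfl

lemma measurable_compoundMeasure {S : Type*} [MeasurableSpace S] :
    Measurable (compoundMeasure (S := S)) := by
  refine Measure.measurable_of_measurable_coe _ fun A hA => ?_
  simp only [compoundMeasure_apply _ hA]
  refine measurable_from_prod_countable_right fun l => ?_
  refine Finset.measurable_sum (Finset.range l) fun k _ => ?_
  have h1 : Measurable fun y : ℕ → ℕ × S => ((y k).1 : ℝ≥0∞) :=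
    Measurable.of_discrete.comp (measurable_fst.comp (measurable_pi_apply k))
  have h2 : Measurable fun y : ℕ → ℕ × S => A.indicator (fun _ => (1 : ℝ≥0∞)) (y k).2 :=
    (measurable_const.indicator hA).comp (measurable_snd.comp (measurable_pi_apply k))
  exact h1.mul h2

lemma lintegral_compoundMeasure {S : Type*} [MeasurableSpace S] (x : ℕ × (ℕ → ℕ × S))
    {g : S → ℝ≥0∞} (hg : Measurable g) :
    ∫⁻ s, g s ∂(compoundMeasure x) = ∑ k ∈ Finset.range x.1, ((x.2 k).1 : ℝ≥0∞) * g (x.2 k).2 := by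
  rw [compoundMeasure, lintegral_finsetSum_measure]
  refine Finset.sum_congr rfl fun k _ => ?_
  rw [lintegral_smul_measure, lintegral_dirac' _ hg, smul_eq_mul]

/-- The Laplace functional of a compound Poisson process. -/
lemma lintegral_expNeg_compoundMeasure {S : Type*} [MeasurableSpace S] (lam : ℝ≥0) (q : Measure ℕ)
    [IsProbabilityMeasure q] (g : Measure S) [IsProbabilityMeasure g] {f : S → ℕ}
    (hf : Measurable f) {m : ℝ} (hm : 0 ≤ m)
    (hfm : ∫⁻ s, ∫⁻ j, expNeg (f s) ^ j ∂q ∂g = ENNReal.ofReal m) :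
    ∫⁻ x, expNeg (∫⁻ s, f s ∂(compoundMeasure x)) ∂(compoundLaw lam q g) =
      ENNReal.ofReal (Real.exp (-(lam * (1 - m)))) := by
  have hf' : Measurable fun s => (f s : ℝ≥0∞) := Measurable.of_discrete.comp hf
  have hh : Measurable fun p : ℕ × S => expNeg ((p.1 : ℝ≥0∞) * f p.2) := by
    refine measurable_expNeg.comp (Measurable.mul ?_ (hf'.comp measurable_snd))
    exact Measurable.of_discrete.comp measurable_fst
  have hm' : ∫⁻ p, expNeg ((p.1 : ℝ≥0∞) * f p.2) ∂(q.prod g) = ENNReal.ofReal m := by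
    rw [lintegral_prod_symm' _ hh, ← hfm]
    simp only [expNeg_natCast_mul]
  -- Given `l` clusters, iid marks contribute `m^l`; averaging over `l` is then the Poisson
  -- generating function at `m`.
  have hl : ∀ l : ℕ, ∫⁻ y : ℕ → ℕ × S, ∏ k ∈ Finset.range l,
      expNeg (((y k).1 : ℝ≥0∞) * f (y k).2) ∂(Measure.infinitePi fun _ => q.prod g) =
      ENNReal.ofReal m ^ l := by
    intro l
    have hind := iIndepFun_infinitePi (P := fun _ : ℕ => q.prod g)
      (X := fun _ p => expNeg ((p.1 : ℝ≥0∞) * f p.2)) fun _ => hh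
    rw [lintegral_prod_eq_prod_lintegral_of_indepFun _ _ hind fun k =>
      hh.comp (measurable_pi_apply k)]
    rw [Finset.prod_congr rfl fun k _ => ((measurePreserving_eval_infinitePi
      (fun _ : ℕ => q.prod g) k).lintegral_comp hh).trans hm']
    simp
  simp only [lintegral_compoundMeasure _ hf', compoundLaw, expNeg_sum]
  rw [lintegral_prod]
  · simp only [hl]
    exact lintegral_pow_poissonMeasure lam hm
  · refine Measurable.aemeasurable (measurable_from_prod_countable_right fun l => ?_)
    exact Finset.measurable_prod (Finset.range l) fun k _ => hh.comp (measurable_pi_apply k)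

/-- The Laplace functional of the compound Poisson process of cluster sizes. -/
lemma lintegral_expNeg_compoundMeasure_sizeLaw {S : Type*} [MeasurableSpace S]
    {ρ : Measure ℝ≥0} {G₀ : Measure S} [IsFiniteMeasure G₀]
    (hρ : Integrable (fun x : ℝ≥0 => min 1 (x : ℝ)) ρ) (h0 : ρ {0}ᶜ ≠ 0) (hG₀ : G₀ ≠ 0)
    {f : S → ℕ} (hf : Measurable f) {M : ℕ} (hM : ∀ s, f s < M) :
    ∫⁻ x, expNeg (∫⁻ s, f s ∂(compoundMeasure x))
        ∂(compoundLaw (clusterRate ρ G₀) (sizeLaw ρ) (baseLaw G₀)) =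
      ENNReal.ofReal (Real.exp (-∑ j ∈ Finset.range M,
        G₀.real (f ⁻¹' {j}) * laplaceExponent ρ (1 - Real.exp (-j)))) := by
  have := isProbabilityMeasure_sizeLaw hρ h0
  have := isProbabilityMeasure_baseLaw hG₀
  have hψ := integral_one_sub_exp_pos hρ h0
  set ψ := ∫ x : ℝ≥0, (1 - Real.exp (-x)) ∂ρ with hψdef
  have hγ : 0 < G₀.real Set.univ := by
    rw [measureReal_def]
    exact ENNReal.toReal_pos (by simpa using hG₀) (measure_ne_top _ _)
  have hc : ∀ j : ℕ, 0 ≤ 1 - laplaceExponent ρ (1 - Real.exp (-(j : ℝ))) / ψ := fun j => by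
    rw [sub_nonneg, div_le_one hψ]
    exact laplaceExponent_le hρ (by simp) (by simp [Real.exp_nonneg])
  have hbase : ∀ A, (baseLaw G₀).real A = G₀.real A / G₀.real Set.univ := fun A => by
    simp [baseLaw, measureReal_def, ENNReal.toReal_mul, ENNReal.toReal_inv, div_eq_inv_mul]
  have hsum : ∑ j ∈ Finset.range M, (baseLaw G₀).real (f ⁻¹' {j}) = 1 := by
    have h1 := lintegral_ofReal_comp_nat (μ := baseLaw G₀) hf hM (c := fun _ => 1)
    simp only [ENNReal.ofReal_one, lintegral_one, measure_univ, one_mul] at h1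
    simp only [measureReal_def]
    rw [← ENNReal.toReal_sum fun j _ => measure_ne_top _ _, ← h1, ENNReal.toReal_one]
  have hm0 : 0 ≤ ∑ j ∈ Finset.range M, (1 - laplaceExponent ρ (1 - Real.exp (-(j : ℝ))) / ψ) *
      (baseLaw G₀).real (f ⁻¹' {j}) :=
    Finset.sum_nonneg fun j _ => mul_nonneg (hc j) measureReal_nonneg
  rw [lintegral_expNeg_compoundMeasure _ _ _ hf hm0]
  · congr 2
    -- Since the `g₀(B_j)` sum to 1, `1 - m = ∑_j g₀(B_j) Φ(1 - e^{-j}) / ψ`; the rate `γ₀ψ` cancels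
    -- both normalisations.
    rw [neg_inj, clusterRate, Real.coe_toNNReal _ (by positivity), ← hψdef]
    simp only [sub_mul, one_mul, Finset.sum_sub_distrib, hsum]
    rw [sub_sub_cancel, Finset.mul_sum]
    refine Finset.sum_congr rfl fun j _ => ?_
    rw [hbase]
    field_simp
  · simp only [expNeg_natCast]
    have h1 : ∀ s, ∫⁻ j, ENNReal.ofReal (Real.exp (-(f s : ℝ))) ^ j ∂(sizeLaw ρ) =
        ENNReal.ofReal (1 - laplaceExponent ρ (1 - Real.exp (-(f s : ℝ))) / ψ) := fun s =>
      lintegral_pow_sizeLaw hρ h0 (Real.exp_nonneg _) (by simp)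
    simp only [h1]
    rw [lintegral_ofReal_comp_nat hf hM
      (c := fun j => 1 - laplaceExponent ρ (1 - Real.exp (-(j : ℝ))) / ψ),
      ENNReal.ofReal_sum_of_nonneg fun j _ => mul_nonneg (hc j) measureReal_nonneg]
    refine Finset.sum_congr rfl fun j _ => ?_
    rw [ENNReal.ofReal_mul (hc j), ofReal_measureReal]

/-! ### Laplace transforms determine measures on `[0, ∞]^ι` -/

section FiniteDimensional

open BoundedContinuousFunction

variable {ι : Type*} [Fintype ι]

lemma toReal_expNeg_le_one (x : ℝ≥0∞) : (expNeg x).toReal ≤ 1 :=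
  ENNReal.toReal_mono ENNReal.one_ne_top (expNeg_le_one x)

/-- The function `x ↦ exp (-xᵢ)` as a bounded continuous function. -/
def expNegCoord (i : ι) : (ι → ℝ≥0∞) →ᵇ ℝ :=
  BoundedContinuousFunction.ofNormedAddCommGroup (fun x => (expNeg (x i)).toReal)
    (by
      have h : Continuous fun x : ι → ℝ≥0∞ => expNeg (x i) :=
        continuous_expNeg.comp (continuous_apply i)
      exact continuous_iff_continuousAt.2 fun x =>
        (ENNReal.tendsto_toReal ((expNeg_le_one _).trans_lt ENNReal.one_lt_top).ne).comp
          h.continuousAt)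
    1 fun x => by
      rw [Real.norm_of_nonneg ENNReal.toReal_nonneg]
      exact toReal_expNeg_le_one _

/-- The algebra generated by the functions `x ↦ exp (-xᵢ)`. -/
def expNegAlgebra (ι : Type*) [Fintype ι] : StarSubalgebra ℝ ((ι → ℝ≥0∞) →ᵇ ℝ) :=
  { Algebra.adjoin ℝ (Set.range (expNegCoord (ι := ι))) with
    star_mem' := fun {a} ha => by
      have : star a = a := by ext; simp
      rwa [this] }

/-- Products of the generators only add exponents, so the algebra is spanned by exactly the
functions whose integrals the Laplace transform at integers prescribes. -/
lemma exists_eq_expNeg_of_mem_closure {g : (ι → ℝ≥0∞) →ᵇ ℝ}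
    (hg : g ∈ Submonoid.closure (Set.range (expNegCoord (ι := ι)))) :
    ∃ k : ι → ℕ, ∀ x, g x = (expNeg (∑ i, k i * x i)).toReal := by
  classical
  induction hg using Submonoid.closure_induction with
  | mem g hg =>
    obtain ⟨i, rfl⟩ := hg
    refine ⟨Pi.single i 1, fun x => ?_⟩
    rw [Finset.sum_eq_single i]
    · simp [expNegCoord]
    · intro j _ hj
      simp [Pi.single_eq_of_ne hj]
    · simp
  | one => exact ⟨0, fun x => by simp⟩
  | mul g g' _ _ ih ih' =>
    obtain ⟨k, hk⟩ := ih
    obtain ⟨k', hk'⟩ := ih'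
    refine ⟨k + k', fun x => ?_⟩
    rw [BoundedContinuousFunction.mul_apply, hk, hk', ← ENNReal.toReal_mul, ← expNeg_add,
      ← Finset.sum_add_distrib]
    simp [add_mul]

/-- Finite measures on `[0, ∞]^ι` are determined by their Laplace transforms at integers. -/
theorem ext_of_lintegral_expNeg {μ ν : Measure (ι → ℝ≥0∞)} [IsFiniteMeasure μ]
    [IsFiniteMeasure ν]
    (h : ∀ k : ι → ℕ, ∫⁻ x, expNeg (∑ i, k i * x i) ∂μ = ∫⁻ x, expNeg (∑ i, k i * x i) ∂ν) :
    μ = ν := by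
  refine ext_of_forall_mem_subalgebra_integral_eq_of_polish (A := expNegAlgebra ι) ?_ ?_
  · intro x y hxy
    obtain ⟨i, hi⟩ := Function.ne_iff.1 hxy
    refine ⟨_, ⟨_, ⟨expNegCoord i, Algebra.subset_adjoin ⟨i, rfl⟩, rfl⟩, rfl⟩, ?_⟩
    intro H
    have H' : (expNeg (x i)).toReal = (expNeg (y i)).toReal := H
    rw [ENNReal.toReal_eq_toReal_iff' ((expNeg_le_one _).trans_lt ENNReal.one_lt_top).ne
      ((expNeg_le_one _).trans_lt ENNReal.one_lt_top).ne] at H'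
    exact hi (expNeg_injective H')
  · intro g hg
    have hg' : g ∈ Submodule.span ℝ
        (Submonoid.closure (Set.range (expNegCoord (ι := ι))) : Set ((ι → ℝ≥0∞) →ᵇ ℝ)) := by
      rw [← Algebra.adjoin_eq_span]
      exact hg
    clear hg
    induction hg' using Submodule.span_induction with
    | mem g hg =>
      obtain ⟨k, hk⟩ := exists_eq_expNeg_of_mem_closure hg
      simp only [hk]
      rw [integral_toReal, integral_toReal, h k]
      · exact Measurable.aemeasurable (by fun_prop)
      · exact Filter.Eventually.of_forall fun x => (expNeg_le_one _).trans_lt ENNReal.one_lt_top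
      · exact Measurable.aemeasurable (by fun_prop)
      · exact Filter.Eventually.of_forall fun x => (expNeg_le_one _).trans_lt ENNReal.one_lt_top
    | zero => simp
    | add g g' _ _ ih ih' =>
      simp only [BoundedContinuousFunction.coe_add, Pi.add_apply]
      rw [integral_add (g.integrable _) (g'.integrable _),
        integral_add (g.integrable _) (g'.integrable _), ih, ih']
    | smul c g _ ih =>
      simp only [BoundedContinuousFunction.coe_smul]
      rw [integral_smul, integral_smul, ih]

end FiniteDimensional

/-! ### Laplace functionals determine laws of random measures -/

section RandomMeasure

variable {S : Type*} [MeasurableSpace S]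

/-- This identifies a law on measures with the law of the process `A ↦ m A`, to which uniqueness of
projective limits applies. -/
lemma measurableSpace_measure_eq_comap :
    (Measure.instMeasurableSpace : MeasurableSpace (Measure S)) =
      MeasurableSpace.comap (fun (m : Measure S) (A : {A : Set S // MeasurableSet A}) => m A.1)
        inferInstance := by
  change (⨆ (s : Set S) (_ : MeasurableSet s), _) = MeasurableSpace.comap _ (⨆ _, _)
  rw [MeasurableSpace.comap_iSup, iSup_subtype']
  simp only [MeasurableSpace.comap_comp]
  rfl

/-- The law of a random measure is determined by its Laplace functional on bounded
integer-valued functions. -/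
theorem ext_of_laplaceFunctional {μ ν : Measure (Measure S)} [IsFiniteMeasure μ]
    [IsFiniteMeasure ν]
    (h : ∀ (f : S → ℕ) (M : ℕ), Measurable f → (∀ s, f s < M) →
      ∫⁻ m, expNeg (∫⁻ s, f s ∂m) ∂μ = ∫⁻ m, expNeg (∫⁻ s, f s ∂m) ∂ν) : μ = ν := by
  let ev : Measure S → {A : Set S // MeasurableSet A} → ℝ≥0∞ := fun m A => m A.1
  have hev : Measurable ev := measurable_pi_lambda _ fun A => Measure.measurable_coe A.2
  have hfin : ∀ I : Finset {A : Set S // MeasurableSet A},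
      (μ.map ev).map I.restrict = (ν.map ev).map I.restrict := by
    intro I
    refine ext_of_lintegral_expNeg fun k => ?_
    -- The function `∑ k_A 1_A` turns the Laplace functional into the joint Laplace transform of the
    -- masses `m A`. The `+ 1` in the next bound makes it strict.
    have hf : Measurable fun s => ∑ A : I, k A * A.1.1.indicator (fun _ => (1 : ℕ)) s :=
      Finset.measurable_sum _ fun A _ => (measurable_const.indicator A.1.2).const_mul _
    have hM : ∀ s, ∑ A : I, k A * A.1.1.indicator (fun _ => (1 : ℕ)) s < ∑ A : I, k A + 1 := by
      intro s
      refine Nat.lt_succ_of_le (Finset.sum_le_sum fun A _ => ?_)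
      by_cases hs : s ∈ A.1.1 <;> simp [hs]
    have hfint : ∀ m : Measure S, ∫⁻ s, ((∑ A : I, k A * A.1.1.indicator (fun _ => (1 : ℕ)) s : ℕ) :
        ℝ≥0∞) ∂m = ∑ A : I, k A * m A.1.1 := by
      intro m
      push_cast
      rw [lintegral_finsetSum]
      · refine Finset.sum_congr rfl fun A _ => ?_
        have : ∀ s, (k A : ℝ≥0∞) * ((A.1.1.indicator (fun _ => (1 : ℕ)) s : ℕ) : ℝ≥0∞) =
            A.1.1.indicator (fun _ => (k A : ℝ≥0∞)) s := by
          intro s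
          by_cases hs : s ∈ A.1.1 <;> simp [hs]
        simp only [this]
        rw [lintegral_indicator A.1.2, setLIntegral_const]
      · intro A _
        have h1 : Measurable (A.1.1.indicator (fun _ => (1 : ℕ))) :=
          measurable_const.indicator A.1.2
        exact (Measurable.of_discrete.comp h1).const_mul _
    have key := h _ _ hf hM
    simp only [hfint] at key
    rw [lintegral_map (by fun_prop) (Finset.measurable_restrict I), lintegral_map (by fun_prop) hev,
      lintegral_map (by fun_prop) (Finset.measurable_restrict I), lintegral_map (by fun_prop) hev]
    exact key
  have hmap : μ.map ev = ν.map ev := by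
    have h1 : IsProjectiveLimit (μ.map ev) fun I => (ν.map ev).map I.restrict := hfin
    have h2 : IsProjectiveLimit (ν.map ev) fun I => (ν.map ev).map I.restrict := fun I => rfl
    exact h1.unique h2
  ext C hC
  rw [measurableSpace_measure_eq_comap] at hC
  obtain ⟨D, hD, rfl⟩ := hC
  have := congrArg (fun m => m D) hmap
  simpa only [Measure.map_apply hev hD] using this

end RandomMeasure

/-! ### Counting the atoms -/

section Clusters

variable {S : Type*} [MeasurableSpace S]

lemma atomic_apply (w : ℕ → ℝ≥0∞) (x : ℕ → S) {A : Set S} (hA : MeasurableSet A) :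
    atomic w x A = ∑' k, w k * A.indicator (fun _ => 1) (x k) := by
  rw [atomic, Measure.sum_apply _ hA]
  refine tsum_congr fun k => ?_
  rw [Measure.smul_apply, Measure.dirac_apply' _ hA, smul_eq_mul]
  rfl

lemma atomic_ne_zero_iff (w : ℕ → ℝ≥0∞) (x : ℕ → S) {A : Set S} (hA : MeasurableSet A) :
    atomic w x A ≠ 0 ↔ ∃ k, w k ≠ 0 ∧ x k ∈ A := by
  rw [atomic_apply _ _ hA, Ne, ENNReal.tsum_eq_zero, not_forall]
  refine exists_congr fun k => ?_
  by_cases hk : x k ∈ A <;> simp [hk]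

lemma measurable_countMeasure {Θ : Type*} [MeasurableSpace Θ] {ω : ℕ → Θ → S} {n : ℕ → Θ → ℕ}
    (hω : ∀ k, Measurable (ω k)) (hn : ∀ k, Measurable (n k)) :
    Measurable (countMeasure ω n) := by
  refine Measure.measurable_of_measurable_coe _ fun A hA => ?_
  simp only [countMeasure, atomic_apply _ _ hA]
  refine Measurable.tsum fun k => Measurable.mul ?_ ?_
  · exact Measurable.of_discrete.comp (hn k)
  · exact (measurable_const.indicator hA).comp (hω k)

lemma compoundMeasure_eq_atomic (x : ℕ × (ℕ → ℕ × S)) :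
    compoundMeasure x =
      atomic (fun k => if k < x.1 then ((x.2 k).1 : ℝ≥0∞) else 0) fun k => (x.2 k).2 := by
  ext A hA
  rw [compoundMeasure_apply _ hA, atomic_apply _ _ hA, tsum_eq_sum (s := Finset.range x.1)]
  · refine Finset.sum_congr rfl fun k hk => ?_
    rw [if_pos (Finset.mem_range.1 hk)]
  · intro k hk
    rw [if_neg (by simpa using hk), zero_mul]

/-- The measures charging at least `j` cells of some partition given by finitely many of the
separating sets `{s | e s i = true}`. -/
def chargesCells (e : S → ℕ → Bool) (j : ℕ) : Set (Measure S) :=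
  {μ | ∃ (m : ℕ) (c : Fin j → Fin m → Bool), Function.Injective c ∧
    ∀ i, μ ((fun s (a : Fin m) => e s a) ⁻¹' {c i}) ≠ 0}

lemma measurableSet_cell {e : S → ℕ → Bool} (he : Measurable e) (m : ℕ) (c : Fin m → Bool) :
    MeasurableSet ((fun s (a : Fin m) => e s a) ⁻¹' {c}) := by
  have : Measurable fun s (a : Fin m) => e s a :=
    measurable_pi_lambda _ fun a => (measurable_pi_apply (a : ℕ)).comp he
  exact this (measurableSet_singleton c)

lemma measurableSet_chargesCells {e : S → ℕ → Bool} (he : Measurable e) (j : ℕ) :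
    MeasurableSet (chargesCells e j) := by
  have : chargesCells e j = ⋃ (m : ℕ) (c : Fin j → Fin m → Bool) (_ : Function.Injective c),
      ⋂ i, {μ | μ ((fun s (a : Fin m) => e s a) ⁻¹' {c i}) = 0}ᶜ := by
    ext μ
    simp [chargesCells]
  rw [this]
  refine MeasurableSet.iUnion fun m => MeasurableSet.iUnion fun c => MeasurableSet.iUnion fun _ =>
    MeasurableSet.iInter fun i => MeasurableSet.compl ?_
  exact Measure.measurable_coe (measurableSet_cell he m (c i)) (measurableSet_singleton 0)

/-- The number of atoms of an atomic measure can be read off finite partitions. -/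
lemma atomic_mem_chargesCells_iff [MeasurableSingletonClass S] {e : S → ℕ → Bool}
    (he : Measurable e) (hinj : Function.Injective e) (w : ℕ → ℝ≥0∞) (x : ℕ → S) (j : ℕ) :
    atomic w x ∈ chargesCells e j ↔ (j : ℕ∞) ≤ {s | atomic w x {s} ≠ 0}.encard := by
  have hatom : ∀ s, atomic w x {s} ≠ 0 ↔ ∃ k, w k ≠ 0 ∧ x k = s := fun s => by
    simpa using atomic_ne_zero_iff w x (measurableSet_singleton s)
  constructor
  · rintro ⟨m, c, hc, hpos⟩
    -- Each charged cell contains an atom, and distinct cells give distinct atoms.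
    choose k hk using fun i => (atomic_ne_zero_iff w x (measurableSet_cell he m (c i))).1 (hpos i)
    have hinj' : Function.Injective fun i => x (k i) := by
      intro i i' h
      refine hc ?_
      have h1 := (hk i).2
      have h2 := (hk i').2
      simp only [Set.mem_preimage, Set.mem_singleton_iff] at h1 h2 h
      rw [← h1, ← h2, h]
    have hsub : Set.range (fun i => x (k i)) ⊆ {s | atomic w x {s} ≠ 0} := by
      rintro _ ⟨i, rfl⟩
      exact (hatom _).2 ⟨k i, (hk i).1, rfl⟩
    calc (j : ℕ∞) = (Set.range fun i => x (k i)).encard := by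
          rw [← Set.image_univ, hinj'.encard_image, Set.encard_univ]
          simp
      _ ≤ _ := Set.encard_le_encard hsub
  · intro h
    obtain ⟨t, ht, htj⟩ := Set.exists_subset_encard_eq h
    have htf : t.Finite := Set.finite_of_encard_eq_coe htj
    have hcard : Nat.card t = j := by
      rw [Nat.card_coe_set_eq, Set.ncard, htj]; rfl
    have : Finite t := htf
    let eq := (Finite.equivFinOfCardEq hcard).symm
    let y : Fin j → S := fun i => (eq i : S)
    have hy : Function.Injective y := Subtype.val_injective.comp eq.injective
    have hsep : ∀ p : Fin j × Fin j, ∃ a : ℕ, p.1 ≠ p.2 → e (y p.1) a ≠ e (y p.2) a := by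
      intro p
      by_cases hp : p.1 = p.2
      · exact ⟨0, fun h => absurd hp h⟩
      · obtain ⟨a, ha⟩ := Function.ne_iff.1 (hinj.ne (hy.ne hp))
        exact ⟨a, fun _ => ha⟩
    choose a ha using hsep
    -- `a` picks a coordinate separating each pair of the `j` chosen atoms; keeping all coordinates
    -- up to the largest puts the atoms in distinct cells.
    refine ⟨Finset.univ.sup a + 1, fun i b => e (y i) b, ?_, fun i => ?_⟩
    · intro i i' h
      by_contra hne
      refine ha (i, i') hne ?_
      exact congrFun h ⟨a (i, i'), Nat.lt_succ_of_le (Finset.le_sup (Finset.mem_univ (i, i')))⟩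
    · obtain ⟨k, hk, hxk⟩ := (hatom _).1 (ht (eq i).2)
      refine (atomic_ne_zero_iff w x (measurableSet_cell he _ _)).2 ⟨k, hk, ?_⟩
      simp [hxk, y]

lemma encard_eq_iff_chargesCells [MeasurableSingletonClass S] {e : S → ℕ → Bool}
    (he : Measurable e) (hinj : Function.Injective e) (w : ℕ → ℝ≥0∞) (x : ℕ → S) (j : ℕ) :
    {s | atomic w x {s} ≠ 0}.encard = j ↔
      atomic w x ∈ chargesCells e j \ chargesCells e (j + 1) := by
  rw [Set.mem_sdiff, atomic_mem_chargesCells_iff he hinj, atomic_mem_chargesCells_iff he hinj,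
    not_le, Nat.cast_add, Nat.cast_one, ENat.lt_natCast_add_one_iff, and_comm, le_antisymm_iff]

lemma encard_atoms_compoundMeasure [MeasurableSingletonClass S] (x : ℕ × (ℕ → ℕ × S))
    (hn : ∀ k, (x.2 k).1 ≠ 0) (hω : Function.Injective fun k => (x.2 k).2) :
    {s | compoundMeasure x {s} ≠ 0}.encard = x.1 := by
  have : {s | compoundMeasure x {s} ≠ 0} = (fun k => (x.2 k).2) '' (Finset.range x.1) := by
    ext s
    rw [compoundMeasure_eq_atomic]
    change atomic _ _ _ ≠ 0 ↔ _
    rw [atomic_ne_zero_iff _ _ (measurableSet_singleton s)]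
    simp [hn]
  rw [this, hω.encard_image, Set.encard_coe_eq_coe_finsetCard, Finset.card_range]

instance isProbabilityMeasure_compoundLaw (lam : ℝ≥0) (q : Measure ℕ) [IsProbabilityMeasure q]
    (g : Measure S) [IsProbabilityMeasure g] : IsProbabilityMeasure (compoundLaw lam q g) := by
  unfold compoundLaw
  infer_instance

section Laws

variable (lam : ℝ≥0) (q : Measure ℕ) [IsProbabilityMeasure q] (g : Measure S)
  [IsProbabilityMeasure g]

lemma measurePreserving_fst_compoundLaw :
    MeasurePreserving Prod.fst (compoundLaw lam q g) (poissonMeasure lam) :=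
  measurePreserving_fst

lemma measurePreserving_eval_compoundLaw (k : ℕ) :
    MeasurePreserving (fun x : ℕ × (ℕ → ℕ × S) => x.2 k) (compoundLaw lam q g) (q.prod g) :=
  (measurePreserving_eval_infinitePi (fun _ : ℕ => q.prod g) k).comp measurePreserving_snd

lemma ae_size_ne_zero_compoundLaw (hq : q {0} = 0) :
    ∀ᵐ x ∂(compoundLaw lam q g), ∀ k, (x.2 k).1 ≠ 0 := by
  refine ae_all_iff.2 fun k => ?_
  have h := measurePreserving_fst.comp (measurePreserving_eval_compoundLaw lam q g k)
  have h0 : ∀ᵐ j ∂q, j ≠ 0 := by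
    rw [ae_iff]; simpa using hq
  exact h.quasiMeasurePreserving.ae h0

/-- The diagonal is measurable because `e` is injective into the Cantor space, and it is null by
Fubini, its slices being singletons. A countable union over pairs of indices finishes. -/
lemma ae_injective_location_compoundLaw [NullSingletonClass g] {e : S → ℕ → Bool}
    (he : Measurable e) (hinj : Function.Injective e) :
    ∀ᵐ x ∂(compoundLaw lam q g), Function.Injective fun k => (x.2 k).2 := by
  have hdiag : MeasurableSet {p : S × S | p.1 = p.2} := by
    have : {p : S × S | p.1 = p.2} = {p | e p.1 = e p.2} := by
      ext p; exact hinj.eq_iff.symm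
    rw [this]
    exact measurableSet_eq_fun (he.comp measurable_fst) (he.comp measurable_snd)
  have hnull : ∀ᵐ p ∂(g.prod g), p.1 ≠ p.2 := by
    rw [ae_iff]
    simp only [ne_eq, not_not]
    rw [Measure.measure_prod_null hdiag]
    refine Filter.Eventually.of_forall fun s => ?_
    have : Prod.mk s ⁻¹' {p : S × S | p.1 = p.2} = {s} := by ext; simp [eq_comm]
    simp only [this, measure_singleton, Pi.zero_apply]
  have hpair : ∀ i j : ℕ, i ≠ j → ∀ᵐ x ∂(compoundLaw lam q g), (x.2 i).2 ≠ (x.2 j).2 := by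
    intro i j hij
    have h1 : MeasurePreserving (fun y : ℕ → ℕ × S => (y i, y j))
        (Measure.infinitePi fun _ => q.prod g) ((q.prod g).prod (q.prod g)) :=
      ⟨by fun_prop, Measure.infinitePi_map_eval_prod hij⟩
    have h2 : MeasurePreserving (Prod.map Prod.snd Prod.snd)
        ((q.prod g).prod (q.prod g)) (g.prod g) := measurePreserving_snd.prod measurePreserving_snd
    have h3 : MeasurePreserving Prod.snd (compoundLaw lam q g)
        (Measure.infinitePi fun _ => q.prod g) := measurePreserving_snd
    exact ((h2.comp h1).comp h3).quasiMeasurePreserving.ae hnull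
  have hall : ∀ᵐ x ∂(compoundLaw lam q g), ∀ i j : ℕ, i ≠ j → (x.2 i).2 ≠ (x.2 j).2 :=
    ae_all_iff.2 fun i => ae_all_iff.2 fun j => ae_all_iff.2 fun hij => hpair i j hij
  filter_upwards [hall] with x hx i j hij
  by_contra hne
  exact hx i j hne hij

/-- Almost surely the sizes are nonzero and the locations distinct, so the event agrees up to a null
set with the event that the Poisson count is `j`. -/
lemma compoundLaw_encard_atoms [NullSingletonClass g] [MeasurableSpace.CountablySeparated S]
    (hq : q {0} = 0) (j : ℕ) :
    compoundLaw lam q g {x | {s | compoundMeasure x {s} ≠ 0}.encard = j} =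
      poissonMeasure lam {j} := by
  have := MeasurableSpace.measurableSingletonClass_of_countablySeparated (α := S)
  obtain ⟨e, he, hinj⟩ := MeasurableSpace.measurable_injection_nat_bool_of_countablySeparated S
  rw [← (measurePreserving_fst_compoundLaw lam q g).measure_preimage
    (measurableSet_singleton j).nullMeasurableSet]
  refine measure_congr ?_
  filter_upwards [ae_size_ne_zero_compoundLaw lam q g hq,
    ae_injective_location_compoundLaw lam q g he hinj] with x hx hx'
  refine propext ?_
  change {s | compoundMeasure x {s} ≠ 0}.encard = j ↔ x.1 = j
  rw [encard_atoms_compoundMeasure x hx hx', Nat.cast_inj]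

end Laws

end Clusters

/-! ### Equality in law and the compound Poisson representation -/

section Main

variable {S : Type*} [MeasurableSpace S] {Θ : Type*} [MeasurableSpace Θ]
  {P : Measure Θ} [IsProbabilityMeasure P] {ρ : Measure ℝ≥0} {G₀ : Measure S} [IsFiniteMeasure G₀]
  {r : ℕ → Θ → ℝ≥0} {ω : ℕ → Θ → S} {n : ℕ → Θ → ℕ}

/-- The count measure and the compound Poisson measure have the same law. -/
theorem IsCountMixtureModel.identDistrib (h : IsCountMixtureModel P (ρ.prod G₀) r ω n)
    (hρ : Integrable (fun x : ℝ≥0 => min 1 (x : ℝ)) ρ) (h0 : ρ {0}ᶜ ≠ 0) (hG₀ : G₀ ≠ 0) :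
    IdentDistrib (countMeasure ω n) compoundMeasure P
      (compoundLaw (clusterRate ρ G₀) (sizeLaw ρ) (baseLaw G₀)) := by
  have := isProbabilityMeasure_sizeLaw hρ h0
  have := isProbabilityMeasure_baseLaw hG₀
  have hX := measurable_countMeasure h.measurable_atom h.measurable_count
  have hY := measurable_compoundMeasure (S := S)
  refine ⟨hX.aemeasurable, hY.aemeasurable, ext_of_laplaceFunctional fun f M hf hM => ?_⟩
  have hf' : Measurable fun m : Measure S => expNeg (∫⁻ s, f s ∂m) :=
    measurable_expNeg.comp (Measure.measurable_lintegral (Measurable.of_discrete.comp hf))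
  rw [lintegral_map hf' hX, lintegral_map hf' hY, h.lintegral_expNeg_eq hρ hf hM,
    lintegral_expNeg_compoundMeasure_sizeLaw hρ h0 hG₀ hf hM]

theorem IsCountMixtureModel.isCompoundPoissonProcess
    (h : IsCountMixtureModel P (ρ.prod G₀) r ω n)
    (hρ : Integrable (fun x : ℝ≥0 => min 1 (x : ℝ)) ρ) (h0 : ρ {0}ᶜ ≠ 0) (hG₀ : G₀ ≠ 0) :
    IsCompoundPoissonProcess P (countMeasure ω n) (clusterRate ρ G₀) (sizeLaw ρ)
      (baseLaw G₀) := by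
  have := isProbabilityMeasure_sizeLaw hρ h0
  have := isProbabilityMeasure_baseLaw hG₀
  set Q := compoundLaw (clusterRate ρ G₀) (sizeLaw ρ) (baseLaw G₀)
  have hfst := measurePreserving_fst_compoundLaw (clusterRate ρ G₀) (sizeLaw ρ) (baseLaw G₀)
  have heval := measurePreserving_eval_compoundLaw (clusterRate ρ G₀) (sizeLaw ρ) (baseLaw G₀)
  have hn := fun k => measurePreserving_fst.comp (heval k)
  have hω := fun k => measurePreserving_snd.comp (heval k)
  refine ⟨ℕ × (ℕ → ℕ × S), inferInstance, Q, inferInstance, Prod.fst, fun k x => (x.2 k).1,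
    fun k x => (x.2 k).2, ⟨hfst.measurable.aemeasurable, hfst.map_eq⟩,
    fun k => ⟨(hn k).measurable.aemeasurable, (hn k).map_eq⟩,
    fun k => ⟨(hω k).measurable.aemeasurable, (hω k).map_eq⟩, fun k => ?_, ?_, ?_,
    h.identDistrib hρ h0 hG₀⟩
  · refine (indepFun_iff_map_prod_eq_prod_map_map (hn k).measurable.aemeasurable
      (hω k).measurable.aemeasurable).2 ?_
    exact (heval k).map_eq.trans (congrArg₂ Measure.prod (hn k).map_eq.symm (hω k).map_eq.symm)
  · have hsnd : MeasurePreserving Prod.snd Q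
        (Measure.infinitePi fun _ => (sizeLaw ρ).prod (baseLaw G₀)) := measurePreserving_snd
    rw [iIndepFun_iff_map_fun_eq_infinitePi_map fun k => (heval k).measurable]
    refine hsnd.map_eq.trans (congrArg Measure.infinitePi (funext fun k => ?_))
    exact (heval k).map_eq.symm
  · exact indepFun_prod (X := fun l : ℕ => l) (Y := fun y : ℕ → ℕ × S => y)
      measurable_id measurable_id

end Main

end CountMixture

end

theorem mainTheorem1 {S : Type*} [MeasurableSpace S] {Θ : Type*} [MeasurableSpace Θ]
    (P : Measure Θ) [IsProbabilityMeasure P]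
    (ρ : Measure ℝ≥0) (G₀ : Measure S) [IsFiniteMeasure G₀]
    (hρ : ρ {0}ᶜ ≠ 0) (hG₀ : G₀ ≠ 0)
    (hν : CountMixture.IsLevyMeasure (ρ.prod G₀))
    (r : ℕ → Θ → ℝ≥0) (ω : ℕ → Θ → S) (n : ℕ → Θ → ℕ)
    (hmodel : CountMixture.IsCountMixtureModel P (ρ.prod G₀) r ω n) :
    -- the integrals in the formulas are finite, and the denominator is positive
    Integrable (fun x : ℝ≥0 => 1 - Real.exp (-x)) ρ ∧
    0 < ∫ x : ℝ≥0, (1 - Real.exp (-x)) ∂ρ ∧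
    (∀ j : ℕ, 1 ≤ j → Integrable (fun x : ℝ≥0 => (x : ℝ) ^ j * Real.exp (-x)) ρ) ∧
    -- `X` is a compound Poisson process
    CountMixture.IsCompoundPoissonProcess P (CountMixture.countMeasure ω n)
      (CountMixture.clusterRate ρ G₀) (CountMixture.sizeLaw ρ) (CountMixture.baseLaw G₀) ∧
    -- the number of distinct atoms of `X` is Poisson, for a continuous base measure on a space
    -- whose points are separated by countably many measurable sets
    (NullSingletonClass G₀ → MeasurableSpace.CountablySeparated S → ∀ j : ℕ,
      P {θ | {s : S | CountMixture.countMeasure ω n θ {s} ≠ 0}.encard = j} =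
        poissonMeasure (CountMixture.clusterRate ρ G₀) {j}) := by
  have hmin := hν.integrable_min hG₀
  refine ⟨by simpa using CountMixture.integrable_one_sub_exp hmin zero_le_one,
    CountMixture.integral_one_sub_exp_pos hmin hρ,
    fun j hj => CountMixture.integrable_pow_mul_exp hmin hj,
    hmodel.isCompoundPoissonProcess hmin hρ hG₀, fun hna hsep j => ?_⟩
  have := CountMixture.isProbabilityMeasure_sizeLaw hmin hρ
  have := CountMixture.isProbabilityMeasure_baseLaw hG₀
  have : NullSingletonClass (CountMixture.baseLaw G₀) :=
    ⟨fun s => by simp [CountMixture.baseLaw]⟩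
  have := MeasurableSpace.measurableSingletonClass_of_countablySeparated (α := S)
  obtain ⟨e, he, hinj⟩ := MeasurableSpace.measurable_injection_nat_bool_of_countablySeparated S
  -- The condition of having `j` atoms is replaced by a measurable set of measures that agrees with
  -- it on atomic measures, so that equality in law can be applied.
  have hT : MeasurableSet (CountMixture.chargesCells e j \ CountMixture.chargesCells e (j + 1)) :=
    (CountMixture.measurableSet_chargesCells he j).diff
      (CountMixture.measurableSet_chargesCells he (j + 1))
  rw [← CountMixture.compoundLaw_encard_atoms _ (CountMixture.sizeLaw ρ)
    (CountMixture.baseLaw G₀) CountMixture.sizeLaw_singleton_zero j]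
  convert (hmodel.identDistrib hmin hρ hG₀).measure_mem_eq hT using 2
  · ext θ
    exact CountMixture.encard_eq_iff_chargesCells he hinj _ _ j
  · ext x
    rw [Set.mem_preimage, CountMixture.compoundMeasure_eq_atomic,
      ← CountMixture.encard_eq_iff_chargesCells he hinj, ← CountMixture.compoundMeasure_eq_atomic]
    rfl
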